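/- Let $(M,g)$ be a non-empty compact smooth Riemannian manifold of dimension $3$ without boundary, with volume measure $dV$, and let $\varphi : M \to \mathbb{R}^4$ be an isometric immersion of class $C^2$ whose image lies in the closed ball $B^4(0,R)$ of radius $R>0$ centred at the origin. Let $K$ be the Gauss--Kronecker curvature of $\varphi$, that is, the product of the principal curvatures (the determinant of the shape operator with respect to a local unit normal; $|K|$ does not depend on the choice of the normal), and let $T(M)=\int_M |K|\,dV$ be the total curvature. If, for some $0<\alpha<6$, the Ricci curvature of $(M,g)$ satisfies $$\mathrm{Ric}(v,v)\ \ge\ -\frac{\alpha}{R^2}\,g(v,v)\qquad\text{for all tangent vectors } v,$$ then $\mathrm{vol}(M)$ and $T(M)$ are finite and $$\mathrm{vol}(M)\ <\ \frac{6}{6-\alpha}\,R^3\,T(M).$$ -/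

import Mathlib

open Set MeasureTheory
open scoped Manifold ContDiff Matrix

noncomputable section

namespace Hypersurface

/-- The model space `ℝ³` of the manifold. -/
abbrev E3 : Type := EuclideanSpace ℝ (Fin 3)

/-- The ambient Euclidean space `ℝ⁴`. -/
abbrev E4 : Type := EuclideanSpace ℝ (Fin 4)

/-- The `i`-th standard basis vector of `ℝ³`. -/
def stdVec (i : Fin 3) : E3 := EuclideanSpace.single i 1

/-- The partial derivative `∂ᵢ f` at `y`. -/
def pd {V : Type*} [NormedAddCommGroup V] [NormedSpace ℝ V]
    (i : Fin 3) (f : E3 → V) (y : E3) : V :=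
  fderiv ℝ f y (stdVec i)

/-! ### Intrinsic curvature in coordinates -/

/-- Christoffel symbols of the second kind of a metric with coefficient matrix `G`,
`Γᵏᵢⱼ = ½ ∑ₗ gᵏˡ (∂ᵢ gⱼₗ + ∂ⱼ gᵢₗ - ∂ₗ gᵢⱼ)`. -/
def christoffel (G : E3 → Matrix (Fin 3) (Fin 3) ℝ) (k i j : Fin 3) (y : E3) : ℝ :=
  (1 / 2) * ∑ l, (G y)⁻¹ k l *
    (pd i (fun z => G z j l) y + pd j (fun z => G z i l) y - pd l (fun z => G z i j) y)

/-- Coefficients of the Ricci tensor of a metric with coefficient matrix `G`,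
`Rᵢⱼ = ∑ₖ (∂ₖ Γᵏᵢⱼ - ∂ⱼ Γᵏᵢₖ) + ∑ₖ ∑ₗ (Γᵏₖₗ Γˡᵢⱼ - Γᵏⱼₗ Γˡᵢₖ)`
(with this sign convention the unit round 3-sphere has `Ric = 2 g`). -/
def ricciCoeff (G : E3 → Matrix (Fin 3) (Fin 3) ℝ) (i j : Fin 3) (y : E3) : ℝ :=
  (∑ k, (pd k (christoffel G k i j) y - pd j (christoffel G k i k) y)) +
    ∑ k, ∑ l, (christoffel G k k l y * christoffel G l i j y -
      christoffel G k j l y * christoffel G l i k y)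

/-! ### Immersed parametrized hypersurfaces of `ℝ⁴` -/

/-- The vector product of three vectors of `ℝ⁴`: the vector whose inner product with `w` is
`det (a, b, c, w)`. -/
def cross (a b c : E4) : E4 :=
  WithLp.toLp 2 fun k => (Matrix.of ![a.ofLp, b.ofLp, c.ofLp, Pi.single k 1]).det

/-- The unit normal `ν` of a parametrized hypersurface `F`. -/
def unitNormal (F : E3 → E4) (y : E3) : E4 :=
  ‖cross (pd 0 F y) (pd 1 F y) (pd 2 F y)‖⁻¹ • cross (pd 0 F y) (pd 1 F y) (pd 2 F y)

/-- The matrix `⟨∂ᵢF, ∂ⱼF⟩` of the first fundamental form. -/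
def firstForm (F : E3 → E4) (y : E3) : Matrix (Fin 3) (Fin 3) ℝ :=
  Matrix.of fun i j => inner ℝ (pd i F y) (pd j F y)

/-- The matrix `⟨∂ᵢ∂ⱼF, ν⟩` of the second fundamental form. -/
def secondForm (F : E3 → E4) (y : E3) : Matrix (Fin 3) (Fin 3) ℝ :=
  Matrix.of fun i j => inner ℝ (pd i (pd j F) y) (unitNormal F y)

/-- The Gauss-Kronecker curvature: the determinant of the shape operator, i.e. the product of
the principal curvatures. Its sign depends on the choice of unit normal. -/
def gaussKroneckerCoord (F : E3 → E4) (y : E3) : ℝ :=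
  ((firstForm F y)⁻¹ * secondForm F y).det

/-! ### Riemannian 3-manifolds -/

section Manifold

variable {M : Type*} [TopologicalSpace M] [ChartedSpace E3 M]

/-- The `i`-th coordinate vector field of the chart at `x`, evaluated at the point of `M` with
coordinates `y`. -/
def coordVec (x : M) (i : Fin 3) (y : E3) : TangentSpace (𝓡 3) ((chartAt E3 x).symm y) :=
  mfderiv (𝓡 3) (𝓡 3) (chartAt E3 x).symm y (stdVec i)

variable [IsManifold (𝓡 3) ∞ M]

variable (M) in
/-- Smooth Riemannian metrics on `M`. -/
abbrev SmoothMetric : Type _ :=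
  Bundle.ContMDiffRiemannianMetric (𝓡 3) ∞ E3 (fun p : M => TangentSpace (𝓡 3) p)

/-- The coefficients `gᵢⱼ` of the metric in the chart at `x`. -/
def metricCoeff (g : SmoothMetric M) (x : M) (y : E3) : Matrix (Fin 3) (Fin 3) ℝ :=
  Matrix.of fun i j => g.inner ((chartAt E3 x).symm y) (coordVec x i y) (coordVec x j y)

/-- The Ricci tensor of `g` at `p`, computed in the chart at `p`. -/
def ricci (g : SmoothMetric M) (p : M) (v w : TangentSpace (𝓡 3) p) : ℝ :=
  let v' : E3 := mfderiv (𝓡 3) (𝓡 3) (chartAt E3 p) p v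
  let w' : E3 := mfderiv (𝓡 3) (𝓡 3) (chartAt E3 p) p w
  ∑ i, ∑ j, ricciCoeff (metricCoeff g p) i j (chartAt E3 p p) * v' i * w' j

variable [MeasurableSpace M]

/-- The Riemannian volume measure of the domain of the chart at `x`, as a measure on `M`: the
image of `√(det gᵢⱼ) dy` on the target of the chart. -/
def chartVolume (g : SmoothMetric M) (x : M) : Measure M :=
  ((volume.restrict (chartAt E3 x).target).withDensity
    (fun y => ENNReal.ofReal √(metricCoeff g x y).det)).map (chartAt E3 x).symm

/-- The Riemannian volume measure. The measures `chartVolume g x` agree on overlaps of charts, so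
that their least upper bound is the measure which restricts to each of them on the domain of
the corresponding chart. -/
def vol (g : SmoothMetric M) : Measure M := ⨆ x : M, chartVolume g x

end Manifold

section Immersion

variable {M : Type*} [TopologicalSpace M] [ChartedSpace E3 M]

/-- The Gauss-Kronecker curvature of `φ` at `p`, for the unit normal attached to the orientation
of the chart at `p`; its absolute value does not depend on this choice. -/
def gaussKronecker (φ : M → E4) (p : M) : ℝ :=
  gaussKroneckerCoord (φ ∘ (chartAt E3 p).symm) (chartAt E3 p p)

variable [IsManifold (𝓡 3) ∞ M]

/-- `φ` is an isometric immersion of class `C²` of `(M, g)` into `ℝ⁴`. -/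
structure IsIsometricImmersion (g : SmoothMetric M) (φ : M → E4) : Prop where
  contMDiff : ContMDiff (𝓡 3) (𝓡 4) 2 φ
  isometric : ∀ (p : M) (v w : TangentSpace (𝓡 3) p),
    inner (E := E4) ℝ (mfderiv (𝓡 3) (𝓡 4) φ p v) (mfderiv (𝓡 3) (𝓡 4) φ p w) = g.inner p v w

/-- The total curvature `T(M) = ∫_M |K| dV`. -/
def totalCurvature [MeasurableSpace M] (g : SmoothMetric M) (φ : M → E4) : ℝ :=
  ∫ p, |gaussKronecker φ p| ∂(vol g)

end Immersion

end Hypersurface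

end

/-!
Let `X` be the position vector of the hypersurface, `ν` a unit normal, `p = ⟨X, ν⟩` the support
function and `Xᵀ` the tangential part of `X`. The 2-form
`ω = det (X, ν, dX, dX) + p det (X, ν, dX, dν) + p² det (X, ν, dν, dν)` changes sign with `ν`, so
that it can be integrated without an orientation. By the Weingarten and Gauss equations
`dω = (6 + Ric(Xᵀ, Xᵀ) + 2 p K (3 p² - 2 |Xᵀ|²)) dV`, and the integral of `dω` vanishes by the
Stokes theorem. Since `|Xᵀ|² + p² ≤ R²`, the last summand is at most `6 R³ |K|` in absolute value,
hence `6 vol(M) - (α / R²) ∫ |Xᵀ|² dV ≤ 6 R³ T(M)`. Finally `∫ |Xᵀ|² dV < R² vol(M)`, with strict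
inequality because `Xᵀ` vanishes at a point of the hypersurface farthest from the origin.

As the immersion is only of class `C²`, the form `ω` is only of class `C¹` in its coefficients and
in the functions it differentiates; the Stokes theorem is obtained for it by mollification, and the
Gauss equation first in the sense of distributions.
-/

noncomputable section

namespace Hypersurface

open Filter Topology

section PartialDerivatives

variable {V W : Type*} [NormedAddCommGroup V] [NormedSpace ℝ V]
  [NormedAddCommGroup W] [NormedSpace ℝ W] {i j : Fin 3} {y : E3}

lemma norm_stdVec (i : Fin 3) : ‖stdVec i‖ = 1 := by simp [stdVec]

lemma eq_sum_smul_stdVec (v : E3) : v = ∑ i, v i • stdVec i := by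
  simpa [stdVec] using ((EuclideanSpace.basisFun (Fin 3) ℝ).sum_repr v).symm

lemma pd_congr {f f' : E3 → V} (h : f =ᶠ[𝓝 y] f') : pd i f y = pd i f' y := by
  rw [pd, h.fderiv_eq, pd]

lemma pd_eventuallyEq {f f' : E3 → V} (h : f =ᶠ[𝓝 y] f') : pd i f =ᶠ[𝓝 y] pd i f' := by
  filter_upwards [h.eventuallyEq_nhds] with z hz using pd_congr hz

lemma norm_pd_le (i : Fin 3) (f : E3 → V) (y : E3) : ‖pd i f y‖ ≤ ‖fderiv ℝ f y‖ := by
  simpa [pd, norm_stdVec] using (fderiv ℝ f y).le_opNorm (stdVec i)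

lemma pd_const (i : Fin 3) (c : V) (y : E3) : pd i (fun _ => c) y = 0 := by
  simp [pd]

lemma pd_coordinate (i m : Fin 3) (y : E3) : pd i (fun z => z m) y = if i = m then 1 else 0 := by
  have : pd i (fun z : E3 => z m) y = stdVec i m :=
    congrArg (fun L : E3 →L[ℝ] ℝ => L (stdVec i))
      (EuclideanSpace.proj (𝕜 := ℝ) m : E3 →L[ℝ] ℝ).fderiv
  rw [this, stdVec, PiLp.single_apply]
  simp only [eq_comm]

lemma pd_sub {f h : E3 → V} (hf : DifferentiableAt ℝ f y) (hh : DifferentiableAt ℝ h y) :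
    pd i (fun z => f z - h z) y = pd i f y - pd i h y := by
  simp [pd, fderiv_fun_sub hf hh]

lemma pd_sum {ι : Type*} {s : Finset ι} {f : ι → E3 → V}
    (hf : ∀ a ∈ s, DifferentiableAt ℝ (f a) y) :
    pd i (fun z => ∑ a ∈ s, f a z) y = ∑ a ∈ s, pd i (f a) y := by
  simp [pd, fderiv_fun_sum hf]

lemma pd_smul {f : E3 → ℝ} {h : E3 → V} (hf : DifferentiableAt ℝ f y)
    (hh : DifferentiableAt ℝ h y) :
    pd i (fun z => f z • h z) y = pd i f y • h y + f y • pd i h y := by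
  simp [pd, fderiv_fun_smul hf hh, add_comm]

lemma pd_mul {f h : E3 → ℝ} (hf : DifferentiableAt ℝ f y) (hh : DifferentiableAt ℝ h y) :
    pd i (fun z => f z * h z) y = pd i f y * h y + f y * pd i h y :=
  pd_smul hf hh

lemma pd_const_mul (c : ℝ) (f : E3 → ℝ) : pd i (fun z => c * f z) y = c * pd i f y :=
  congrArg (fun L : E3 → E3 →L[ℝ] ℝ => L y (stdVec i)) (fderiv_const_smul_field c)

lemma pd_pow_two {f : E3 → ℝ} (hf : DifferentiableAt ℝ f y) :
    pd i (fun z => f z ^ 2) y = 2 * f y * pd i f y := by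
  simp only [pow_two, pd_mul hf hf]
  ring

lemma pd_inner {V : Type*} [NormedAddCommGroup V] [InnerProductSpace ℝ V] {f h : E3 → V}
    (hf : DifferentiableAt ℝ f y) (hh : DifferentiableAt ℝ h y) :
    pd i (fun z => inner ℝ (f z) (h z)) y =
      inner ℝ (pd i f y) (h y) + inner ℝ (f y) (pd i h y) := by
  simp [pd, fderiv_inner_apply ℝ hf hh, add_comm]

lemma pd_clm_comp (L : V →L[ℝ] W) {f : E3 → V} (hf : DifferentiableAt ℝ f y) :
    pd i (fun z => L (f z)) y = L (pd i f y) :=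
  congrArg (fun T : E3 →L[ℝ] W => T (stdVec i)) (L.hasFDerivAt.comp y hf.hasFDerivAt).fderiv

lemma pd_apply {ι : Type*} [Fintype ι] {f : E3 → EuclideanSpace ℝ ι}
    (hf : DifferentiableAt ℝ f y) (a : ι) : pd i (fun z => f z a) y = pd i f y a :=
  pd_clm_comp (EuclideanSpace.proj a) hf

lemma pd_comm {f : E3 → V} (hf : ContDiffAt ℝ 2 f y) : pd i (pd j f) y = pd j (pd i f) y := by
  have hd : DifferentiableAt ℝ (fderiv ℝ f) y :=
    (hf.fderiv_right (m := 1) (by norm_num)).differentiableAt (by norm_num)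
  have pd_pd : ∀ i j, pd i (pd j f) y = fderiv ℝ (fderiv ℝ f) y (stdVec i) (stdVec j) :=
    fun i j => pd_clm_comp (ContinuousLinearMap.apply ℝ V (stdVec j)) hd
  rw [pd_pd, pd_pd]
  exact hf.isSymmSndFDerivAt (by simp) _ _

lemma contDiffOn_pd {n m : ℕ∞ω} {U : Set E3} (hU : IsOpen U) {f : E3 → V}
    (hf : ContDiffOn ℝ n f U) (h : m + 1 ≤ n) (i : Fin 3) : ContDiffOn ℝ m (pd i f) U :=
  (hf.fderiv_of_isOpen hU h).clm_apply contDiffOn_const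

lemma contDiff_pd {n m : ℕ∞ω} {f : E3 → V} (hf : ContDiff ℝ n f) (h : m + 1 ≤ n) (i : Fin 3) :
    ContDiff ℝ m (pd i f) :=
  (hf.fderiv_right h).clm_apply contDiff_const

lemma continuousOn_pd {U : Set E3} (hU : IsOpen U) {f : E3 → V} (hf : ContDiffOn ℝ 1 f U)
    (i : Fin 3) : ContinuousOn (pd i f) U :=
  (contDiffOn_pd (m := 0) hU hf (by norm_num) i).continuousOn

lemma pd_eq_zero_of_notMem_tsupport {f : E3 → V} (h : y ∉ tsupport f) (i : Fin 3) :
    pd i f y = 0 := by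
  rw [pd, fderiv_of_notMem_tsupport ℝ h, zero_apply]

lemma integrable_pd {f : E3 → V} (hf : ContDiff ℝ 1 f) (hc : HasCompactSupport f) (i : Fin 3) :
    Integrable (pd i f) :=
  (contDiff_pd (m := 0) hf (by norm_num) i).continuous.integrable_of_hasCompactSupport
    (hc.fderiv_apply ℝ _)

lemma integral_pd_eq_zero {f : E3 → ℝ} (hf : ContDiff ℝ 1 f) (hc : HasCompactSupport f)
    (i : Fin 3) : ∫ y, pd i f y = 0 := by
  have := integral_mul_fderiv_eq_neg_fderiv_mul_of_integrable (μ := (volume : Measure E3))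
    (f := fun _ => (1 : ℝ)) (g := f) (v := stdVec i) (by simp)
    (by simpa [pd] using! integrable_pd hf hc i)
    (by simpa using hf.continuous.integrable_of_hasCompactSupport hc)
    (by fun_prop) (fun x _ => hf.differentiable (by norm_num) x)
  simpa [pd] using this

end PartialDerivatives

section Approximation

variable {E F : Type*} [NormedAddCommGroup E] [NormedSpace ℝ E] [NormedAddCommGroup F]
  [NormedSpace ℝ F]

lemma contDiff_of_contDiffOn_of_tsupport_subset {n : ℕ∞ω} {U : Set E} (hU : IsOpen U)
    {f : E → F} (hf : ContDiffOn ℝ n f U) (h : tsupport f ⊆ U) : ContDiff ℝ n f := by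
  refine contDiff_iff_contDiffAt.2 fun y => ?_
  by_cases hy : y ∈ tsupport f
  · exact hf.contDiffAt (hU.mem_nhds (h hy))
  · exact (contDiffAt_const (c := (0 : F))).congr_of_eventuallyEq
      (notMem_tsupport_iff_eventuallyEq.1 hy)

variable [FiniteDimensional ℝ E]

lemma exists_contDiff_norm_fderiv_sub_le [CompleteSpace F] {h : E → F} (hh : ContDiff ℝ 1 h)
    (hc : HasCompactSupport h) {ε : ℝ} (hε : 0 < ε) :
    ∃ f : E → F, ContDiff ℝ ∞ f ∧ ∀ y, ‖fderiv ℝ f y - fderiv ℝ h y‖ ≤ ε := by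
  let : MeasurableSpace E := borel E
  have : BorelSpace E := ⟨rfl⟩
  let μ : Measure E := Measure.addHaar
  have hcont : Continuous (fderiv ℝ h) := hh.continuous_fderiv (by norm_num)
  have huc : UniformContinuous (fderiv ℝ h) :=
    hcont.uniformContinuous_of_tendsto_cocompact (x := 0) (hc.fderiv ℝ).is_zero_at_infty
  obtain ⟨δ, hδ, hδε⟩ := Metric.uniformContinuous_iff.1 huc ε hε
  let b : ContDiffBump (0 : E) := ⟨δ / 2, δ, by positivity, by linarith⟩
  have hbs : ContDiff ℝ ∞ (b.normed μ) := b.contDiff_normed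
  refine ⟨convolution (b.normed μ) h (ContinuousLinearMap.lsmul ℝ ℝ) μ,
    b.hasCompactSupport_normed.contDiff_convolution_left _ hbs hh.continuous.locallyIntegrable,
    fun y => ?_⟩
  have fderiv_convolution : fderiv ℝ (convolution (b.normed μ) h (ContinuousLinearMap.lsmul ℝ ℝ) μ)
      y = convolution (b.normed μ) (fderiv ℝ h) (ContinuousLinearMap.lsmul ℝ ℝ) μ y :=
    (hc.hasFDerivAt_convolution_right (ContinuousLinearMap.lsmul ℝ ℝ)
      hbs.continuous.locallyIntegrable hh y).fderiv
  rw [fderiv_convolution, ← dist_eq_norm]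
  exact b.dist_normed_convolution_le hcont.aestronglyMeasurable fun x hx => (hδε hx).le

lemma exists_contDiff_hasCompactSupport_eventuallyEq {n : ℕ∞} {U K : Set E} (hU : IsOpen U)
    (hK : IsCompact K) (hKU : K ⊆ U) {h : E → F} (hh : ContDiffOn ℝ n h U) :
    ∃ f : E → F, ContDiff ℝ n f ∧ HasCompactSupport f ∧ ∀ y ∈ K, f =ᶠ[𝓝 y] h := by
  obtain ⟨L, hL, hKL, hLU⟩ := exists_compact_between hK hU hKU
  obtain ⟨χ, hχ_one, hχ_zero, -⟩ := exists_contMDiffMap_one_nhds_of_subset_interior (n := n) 𝓘(ℝ, E)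
    hK.isClosed hKL
  have hχ : ContDiff ℝ n χ := contMDiff_iff_contDiff.1 χ.contMDiff
  have hsupp : tsupport (fun y => χ y • h y) ⊆ L := by
    refine closure_minimal (fun y hy => ?_) hL.isClosed
    by_contra hyL
    exact hy (by simp [hχ_zero y hyL])
  refine ⟨fun y => χ y • h y, contDiff_of_contDiffOn_of_tsupport_subset hU
    (hχ.contDiffOn.smul hh) (hsupp.trans hLU), HasCompactSupport.of_support_subset_isCompact hL
    (subset_closure.trans hsupp), fun y hy => ?_⟩
  filter_upwards [hχ_one.filter_mono (nhds_le_nhdsSet hy)] with z hz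
  simp [hz]

end Approximation

/-! ### The Stokes theorem for functions of class `C¹` -/

section Jacobian

/-- The coefficient of `dx⁰ ∧ dx¹ ∧ dx²` in the form `∑ Tᵢⱼₖ dxⁱ ∧ dxʲ ∧ dxᵏ`. -/
def wedgeCoeff (T : Fin 3 → Fin 3 → Fin 3 → ℝ) : ℝ :=
  (T 0 1 2 - T 0 2 1) + (T 1 2 0 - T 1 0 2) + (T 2 0 1 - T 2 1 0)

lemma wedgeCoeff_sum {ι : Type*} (s : Finset ι) (T : ι → Fin 3 → Fin 3 → Fin 3 → ℝ) :
    wedgeCoeff (fun i j k => ∑ a ∈ s, T a i j k) = ∑ a ∈ s, wedgeCoeff (T a) := by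
  simp only [wedgeCoeff, Finset.sum_add_distrib, Finset.sum_sub_distrib]

lemma abs_wedgeCoeff_le {T : Fin 3 → Fin 3 → Fin 3 → ℝ} {C : ℝ} (hT : ∀ i j k, |T i j k| ≤ C) :
    |wedgeCoeff T| ≤ 6 * C := by
  have hsub : ∀ i j k l m n, |T i j k - T l m n| ≤ C + C := fun i j k l m n =>
    (abs_sub _ _).trans (add_le_add (hT i j k) (hT l m n))
  have h := (abs_add_three _ _ _).trans
    (add_le_add_three (hsub 0 1 2 0 2 1) (hsub 1 2 0 1 0 2) (hsub 2 0 1 2 1 0))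
  rw [wedgeCoeff]
  linarith

/-- The coordinate vector of the differential of a function on `ℝ³`. -/
def grad (f : E3 → ℝ) (y : E3) : Fin 3 → ℝ := fun i => pd i f y

/-- The Jacobian determinant of three functions on `ℝ³`, that is, the coefficient of
`du ∧ dv ∧ dw`. -/
def jac (u v w : E3 → ℝ) (y : E3) : ℝ := (Matrix.of ![grad u y, grad v y, grad w y]).det

variable {U : Set E3} {u v w θ : E3 → ℝ} {y : E3}

lemma jac_eq_dotProduct_cross (u v w : E3 → ℝ) (y : E3) :
    jac u v w y = grad u y ⬝ᵥ grad v y ⨯₃ grad w y :=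
  (triple_product_eq_det _ _ _).symm

lemma jac_eq_wedgeCoeff (u v w : E3 → ℝ) (y : E3) :
    jac u v w y = wedgeCoeff fun i j k => pd i u y * (pd j v y * pd k w y) := by
  rw [jac_eq_dotProduct_cross]
  simp only [wedgeCoeff, cross_apply, grad, Matrix.vec3_dotProduct, Matrix.cons_val]
  ring

lemma jac_swap (u v w : E3 → ℝ) (y : E3) : jac u w v y = -jac u v w y := by
  simp only [jac_eq_wedgeCoeff, wedgeCoeff]
  ring

lemma jac_congr {u' v' w' : E3 → ℝ} (hu : u =ᶠ[𝓝 y] u') (hv : v =ᶠ[𝓝 y] v')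
    (hw : w =ᶠ[𝓝 y] w') : jac u v w y = jac u' v' w' y := by
  simp only [jac_eq_wedgeCoeff, pd_congr hu, pd_congr hv, pd_congr hw]

lemma jac_eq_zero_of_notMem_tsupport (h : y ∉ tsupport u) (v w : E3 → ℝ) : jac u v w y = 0 := by
  simp [jac_eq_wedgeCoeff, wedgeCoeff, pd_eq_zero_of_notMem_tsupport h]

lemma jac_sub (u v : E3 → ℝ) {w w' : E3 → ℝ} (hw : DifferentiableAt ℝ w y)
    (hw' : DifferentiableAt ℝ w' y) :
    jac u v (fun z => w z - w' z) y = jac u v w y - jac u v w' y := by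
  simp only [jac_eq_wedgeCoeff, wedgeCoeff, pd_sub hw hw']
  ring

lemma abs_jac_le (u v w : E3 → ℝ) (y : E3) :
    |jac u v w y| ≤ 6 * (‖fderiv ℝ u y‖ * (‖fderiv ℝ v y‖ * ‖fderiv ℝ w y‖)) := by
  rw [jac_eq_wedgeCoeff]
  refine abs_wedgeCoeff_le fun i j k => ?_
  simp only [← Real.norm_eq_abs, norm_mul]
  gcongr <;> exact norm_pd_le _ _ _

lemma continuousOn_jac (hU : IsOpen U) (hu : ContDiffOn ℝ 1 u U) (hv : ContDiffOn ℝ 1 v U)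
    (hw : ContDiffOn ℝ 1 w U) : ContinuousOn (jac u v w) U := by
  have hu' := continuousOn_pd hU hu
  have hv' := continuousOn_pd hU hv
  have hw' := continuousOn_pd hU hw
  simp only [funext (jac_eq_wedgeCoeff u v w), wedgeCoeff]
  fun_prop

lemma integrable_jac (hU : IsOpen U) (hθ : ContDiffOn ℝ 1 θ U) (hc : HasCompactSupport θ)
    (hθU : tsupport θ ⊆ U) (hv : ContDiffOn ℝ 1 v U) (hw : ContDiffOn ℝ 1 w U) :
    Integrable (jac θ v w) := by
  have hsupp : Function.support (jac θ v w) ⊆ tsupport θ := fun y hy => by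
    by_contra h
    exact hy (jac_eq_zero_of_notMem_tsupport h v w)
  rw [← integrableOn_iff_integrable_of_support_subset hsupp]
  exact ((continuousOn_jac hU hθ hv hw).mono hθU).integrableOn_compact hc

lemma contDiff_cross_grad (hv : ContDiff ℝ 2 v) (hw : ContDiff ℝ 2 w) (i : Fin 3) :
    ContDiff ℝ 1 fun z => (grad v z ⨯₃ grad w z) i := by
  have hv' : ∀ i, ContDiff ℝ 1 (pd i v) := contDiff_pd hv (by norm_num)
  have hw' : ∀ i, ContDiff ℝ 1 (pd i w) := contDiff_pd hw (by norm_num)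
  fin_cases i <;> simp only [cross_apply, grad, Fin.reduceFinMk, Fin.zero_eta, Fin.mk_one,
    Matrix.cons_val] <;> fun_prop

lemma sum_pd_cross_grad_eq_zero (hv : ContDiff ℝ 2 v) (hw : ContDiff ℝ 2 w) (y : E3) :
    ∑ i, pd i (fun z => (grad v z ⨯₃ grad w z) i) y = 0 := by
  have hdv : ∀ i, DifferentiableAt ℝ (pd i v) y := fun i =>
    (contDiff_pd (m := 1) hv (by norm_num) i).differentiable (by norm_num) y
  have hdw : ∀ i, DifferentiableAt ℝ (pd i w) y := fun i =>
    (contDiff_pd (m := 1) hw (by norm_num) i).differentiable (by norm_num) y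
  have pd_minor : ∀ k i j, pd k (fun z => pd i v z * pd j w z - pd j v z * pd i w z) y =
      pd k (pd i v) y * pd j w y + pd i v y * pd k (pd j w) y -
      (pd k (pd j v) y * pd i w y + pd j v y * pd k (pd i w) y) := fun k i j => by
    rw [pd_sub ((hdv i).fun_mul (hdw j)) ((hdv j).fun_mul (hdw i)), pd_mul (hdv i) (hdw j),
      pd_mul (hdv j) (hdw i)]
  simp only [Fin.sum_univ_three, cross_apply, grad, Matrix.cons_val, pd_minor]
  rw [pd_comm (i := 1) (j := 0) hv.contDiffAt, pd_comm (i := 2) (j := 0) hv.contDiffAt,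
    pd_comm (i := 2) (j := 1) hv.contDiffAt, pd_comm (i := 1) (j := 0) hw.contDiffAt,
    pd_comm (i := 2) (j := 0) hw.contDiffAt, pd_comm (i := 2) (j := 1) hw.contDiffAt]
  ring

lemma jac_eq_sum_pd_mul_cross_grad (hθ : ContDiff ℝ 1 θ) (hv : ContDiff ℝ 2 v)
    (hw : ContDiff ℝ 2 w) (y : E3) :
    jac θ v w y = ∑ i, pd i (fun z => θ z * (grad v z ⨯₃ grad w z) i) y := by
  have hd : ∀ {f : E3 → ℝ}, ContDiff ℝ 1 f → DifferentiableAt ℝ f y :=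
    fun hf => hf.differentiable (by norm_num) y
  simp only [pd_mul (hd hθ) (hd (contDiff_cross_grad hv hw _)), Finset.sum_add_distrib,
    ← Finset.mul_sum, sum_pd_cross_grad_eq_zero hv hw, mul_zero, add_zero]
  exact jac_eq_dotProduct_cross θ v w y

lemma integral_jac_eq_zero_of_contDiff_two (hθ : ContDiff ℝ 1 θ) (hc : HasCompactSupport θ)
    (hv : ContDiff ℝ 2 v) (hw : ContDiff ℝ 2 w) : ∫ y, jac θ v w y = 0 := by
  have hC : ∀ i, ContDiff ℝ 1 fun z => θ z * (grad v z ⨯₃ grad w z) i := fun i =>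
    hθ.mul (contDiff_cross_grad hv hw i)
  simp only [jac_eq_sum_pd_mul_cross_grad hθ hv hw]
  rw [integral_finsetSum _ fun i _ => integrable_pd (hC i) hc.mul_right i]
  exact Finset.sum_eq_zero fun i _ => integral_pd_eq_zero (hC i) hc.mul_right i

lemma integral_jac_eq_zero_of_approx (hθ : ContDiff ℝ 1 θ) (hc : HasCompactSupport θ)
    (hv : ContDiff ℝ 1 v) (hw : ContDiff ℝ 1 w)
    (happrox : ∀ ε > 0, ∃ f : E3 → ℝ, ContDiff ℝ 1 f ∧
      (∀ y, ‖fderiv ℝ f y - fderiv ℝ w y‖ ≤ ε) ∧ ∫ y, jac θ v f y = 0) :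
    ∫ y, jac θ v w y = 0 := by
  have hd : ∀ {f : E3 → ℝ}, ContDiff ℝ 1 f → Differentiable ℝ f :=
    fun hf => hf.differentiable (by norm_num)
  have hinteg : ∀ {f}, ContDiff ℝ 1 f → Integrable (jac θ v f) := fun hf =>
    integrable_jac isOpen_univ hθ.contDiffOn hc (subset_univ _) hv.contDiffOn hf.contDiffOn
  let C : ℝ := ∫ y, 6 * (‖fderiv ℝ θ y‖ * ‖fderiv ℝ v y‖)
  have hCint : Integrable fun y => 6 * (‖fderiv ℝ θ y‖ * ‖fderiv ℝ v y‖) :=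
    Continuous.integrable_of_hasCompactSupport
      (((hθ.continuous_fderiv (by norm_num)).norm.mul
        (hv.continuous_fderiv (by norm_num)).norm).const_mul 6)
      (((hc.fderiv ℝ).norm.mul_right).mul_left)
  have hbound : ∀ ε > 0, ‖∫ y, jac θ v w y‖ ≤ C * ε := by
    intro ε hε
    obtain ⟨f, hf, hfw, hf0⟩ := happrox ε hε
    rw [← sub_zero (∫ y, jac θ v w y), ← hf0, ← integral_sub (hinteg hw) (hinteg hf),
      ← integral_mul_const]
    refine norm_integral_le_of_norm_le (hCint.mul_const ε) (Eventually.of_forall fun y => ?_)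
    rw [← jac_sub θ v (hd hw y) (hd hf y), Real.norm_eq_abs]
    refine (abs_jac_le _ _ _ _).trans ?_
    rw [fderiv_fun_sub (hd hw y) (hd hf y), norm_sub_rev, mul_assoc, mul_assoc]
    gcongr
    exact hfw y
  refine norm_le_zero_iff.1 (ge_of_tendsto (f := fun ε => C * ε) (x := 𝓝[>] 0) ?_
    (eventually_mem_nhdsWithin.mono hbound))
  exact ((continuous_const_mul C).tendsto' 0 0 (mul_zero C)).mono_left nhdsWithin_le_nhds

lemma integral_jac_eq_zero_of_hasCompactSupport (hθ : ContDiff ℝ 1 θ) (hc : HasCompactSupport θ)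
    (hv : ContDiff ℝ 1 v) (hvc : HasCompactSupport v) (hw : ContDiff ℝ 1 w)
    (hwc : HasCompactSupport w) : ∫ y, jac θ v w y = 0 := by
  refine integral_jac_eq_zero_of_approx hθ hc hv hw fun ε hε => ?_
  obtain ⟨f, hf, hfw⟩ := exists_contDiff_norm_fderiv_sub_le hw hwc hε
  refine ⟨f, hf.of_le (by simp), hfw, ?_⟩
  suffices ∫ y, jac θ f v y = 0 by simpa only [jac_swap θ f v, integral_neg, neg_eq_zero] using this
  refine integral_jac_eq_zero_of_approx hθ hc (hf.of_le (by simp)) hv fun ε hε => ?_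
  obtain ⟨h, hh, hhv⟩ := exists_contDiff_norm_fderiv_sub_le hv hvc hε
  exact ⟨h, hh.of_le (by simp), hhv,
    integral_jac_eq_zero_of_contDiff_two hθ hc (hf.of_le (by norm_cast)) (hh.of_le (by norm_cast))⟩

/-- The Stokes theorem for `d (θ dv ∧ dw)`, under `C¹` regularity only. -/
theorem integral_jac_eq_zero (hU : IsOpen U) (hθ : ContDiffOn ℝ 1 θ U) (hc : HasCompactSupport θ)
    (hθU : tsupport θ ⊆ U) (hv : ContDiffOn ℝ 1 v U) (hw : ContDiffOn ℝ 1 w U) :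
    ∫ y, jac θ v w y = 0 := by
  obtain ⟨v', hv', hvc, hvv⟩ := exists_contDiff_hasCompactSupport_eventuallyEq hU hc hθU hv
  obtain ⟨w', hw', hwc, hww⟩ := exists_contDiff_hasCompactSupport_eventuallyEq hU hc hθU hw
  rw [← integral_jac_eq_zero_of_hasCompactSupport
    (contDiff_of_contDiffOn_of_tsupport_subset hU hθ hθU) hc hv' hvc hw' hwc]
  congr 1 with y
  by_cases hy : y ∈ tsupport θ
  · exact (jac_congr EventuallyEq.rfl (hvv y hy) (hww y hy)).symm
  · rw [jac_eq_zero_of_notMem_tsupport hy, jac_eq_zero_of_notMem_tsupport hy]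

lemma grad_dotProduct (c : Fin 3 → ℝ) (y : E3) : grad (fun z => c ⬝ᵥ z.ofLp) y = c := by
  ext i
  have hcoord : ∀ m, DifferentiableAt ℝ (fun z : E3 => z m) y := fun m => by fun_prop
  simp only [grad, dotProduct]
  rw [pd_sum fun m _ => (hcoord m).const_mul (c m)]
  simp [pd_const_mul, pd_coordinate]

lemma pd_mul_pd_sub_eq_jac (u v : E3 → ℝ) (k j : Fin 3) (y : E3) :
    pd k u y * pd j v y - pd j u y * pd k v y =
      jac u v (fun z => (Pi.single k 1 ⨯₃ Pi.single j 1) ⬝ᵥ z.ofLp) y := by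
  rw [jac_eq_dotProduct_cross, grad_dotProduct, triple_product_permutation,
    triple_product_permutation, dotProduct_comm, cross_dot_cross]
  simp [grad, mul_comm]

lemma integrable_pd_mul_pd_sub (hU : IsOpen U) (hθ : ContDiffOn ℝ 1 θ U) (hc : HasCompactSupport θ)
    (hθU : tsupport θ ⊆ U) (hv : ContDiffOn ℝ 1 v U) (k j : Fin 3) :
    Integrable fun y => pd k θ y * pd j v y - pd j θ y * pd k v y := by
  simp only [pd_mul_pd_sub_eq_jac]
  exact integrable_jac hU hθ hc hθU hv (by simp only [dotProduct]; fun_prop)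

lemma integral_pd_mul_pd_sub_eq_zero (hU : IsOpen U) (hθ : ContDiffOn ℝ 1 θ U)
    (hc : HasCompactSupport θ) (hθU : tsupport θ ⊆ U) (hv : ContDiffOn ℝ 1 v U) (k j : Fin 3) :
    ∫ y, (pd k θ y * pd j v y - pd j θ y * pd k v y) = 0 := by
  simp only [pd_mul_pd_sub_eq_jac]
  exact integral_jac_eq_zero hU hθ hc hθU hv (by simp only [dotProduct]; fun_prop)

end Jacobian

/-! ### Parametrized hypersurfaces -/

section LinearAlgebra

/-- The determinant of four vectors of `ℝ⁴`. -/
def det4 (a b c d : E4) : ℝ := (Matrix.of ![a.ofLp, b.ofLp, c.ofLp, d.ofLp]).det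

lemma det4_eq_laplace (a b c d : E4) : det4 a b c d =
    a 0 * (b 1 * (c 2 * d 3 - c 3 * d 2) - b 2 * (c 1 * d 3 - c 3 * d 1)
      + b 3 * (c 1 * d 2 - c 2 * d 1)) -
    a 1 * (b 0 * (c 2 * d 3 - c 3 * d 2) - b 2 * (c 0 * d 3 - c 3 * d 0)
      + b 3 * (c 0 * d 2 - c 2 * d 0)) +
    a 2 * (b 0 * (c 1 * d 3 - c 3 * d 1) - b 1 * (c 0 * d 3 - c 3 * d 0)
      + b 3 * (c 0 * d 1 - c 1 * d 0)) -
    a 3 * (b 0 * (c 1 * d 2 - c 2 * d 1) - b 1 * (c 0 * d 2 - c 2 * d 0)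
      + b 2 * (c 0 * d 1 - c 1 * d 0)) := by
  simp [det4, Matrix.det_succ_row_zero, Fin.sum_univ_succ, Fin.succAbove]
  ring

lemma det4_sum_smul (A : Matrix (Fin 4) (Fin 4) ℝ) (e : Fin 4 → E4) :
    det4 (∑ i, A 0 i • e i) (∑ i, A 1 i • e i) (∑ i, A 2 i • e i) (∑ i, A 3 i • e i) =
      A.det * det4 (e 0) (e 1) (e 2) (e 3) := by
  rw [det4, det4, ← Matrix.det_mul]
  congr 1
  ext i j
  fin_cases i <;> simp [Matrix.mul_apply, Fin.sum_univ_four]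

lemma sum_det4_single_left (x y u v : E4) :
    ∑ k, ∑ l, x k * y l * det4 (EuclideanSpace.single k 1) (EuclideanSpace.single l 1) u v =
      det4 x y u v := by
  simp only [det4_eq_laplace, Fin.sum_univ_four]
  simp
  ring

lemma sum_det4_single_right (x y u v : E4) :
    ∑ a, ∑ b, det4 x y (EuclideanSpace.single a 1) (EuclideanSpace.single b 1) * (u a * v b) =
      det4 x y u v := by
  simp only [det4_eq_laplace, Fin.sum_univ_four]
  simp
  ring

lemma inner_eq_sum_four (v w : E4) :
    inner ℝ v w = v 0 * w 0 + v 1 * w 1 + v 2 * w 2 + v 3 * w 3 := by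
  simp [PiLp.inner_apply, Fin.sum_univ_four, mul_comm]

lemma ofLp_cross (a b c : E4) (k : Fin 4) :
    cross a b c k = det4 a b c (EuclideanSpace.single k 1) := rfl

lemma inner_cross (a b c w : E4) : inner ℝ (cross a b c) w = det4 a b c w := by
  simp only [inner_eq_sum_four, ofLp_cross, det4_eq_laplace]
  simp
  ring

lemma inner_cross_self (e : Fin 3 → E4) :
    inner ℝ (cross (e 0) (e 1) (e 2)) (cross (e 0) (e 1) (e 2)) = (Matrix.gram ℝ e).det := by
  simp only [Matrix.det_fin_three, Matrix.gram_apply, inner_eq_sum_four, ofLp_cross,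
    det4_eq_laplace]
  simp
  ring

lemma inner_cross_right (e : Fin 3 → E4) (i : Fin 3) :
    inner ℝ (e i) (cross (e 0) (e 1) (e 2)) = 0 := by
  rw [real_inner_comm, inner_cross, det4_eq_laplace]
  fin_cases i <;> (simp; ring)

lemma eq_zero_of_inner_eq_zero {a b c d w : E4} (h : det4 a b c d ≠ 0) (ha : inner ℝ a w = 0)
    (hb : inner ℝ b w = 0) (hc : inner ℝ c w = 0) (hd : inner ℝ d w = 0) : w = 0 := by
  refine (WithLp.ofLp_eq_zero 2).1 (Matrix.eq_zero_of_mulVec_eq_zero h ?_)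
  rw [inner_eq_sum_four] at ha hb hc hd
  ext i
  fin_cases i <;> simpa [Matrix.mulVec, dotProduct, Fin.sum_univ_four]

lemma eq_sum_smul_add_inner_smul {V ι : Type*} [NormedAddCommGroup V] [InnerProductSpace ℝ V]
    [Fintype ι] [DecidableEq ι] {e : ι → V} {ν : V} (hdet : (Matrix.gram ℝ e).det ≠ 0)
    (hν : ‖ν‖ = 1) (hνe : ∀ i, inner ℝ (e i) ν = (0 : ℝ))
    (hspan : ∀ w, (∀ i, inner ℝ (e i) w = (0 : ℝ)) → inner ℝ ν w = (0 : ℝ) → w = 0) (w : V) :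
    w = ∑ k, (∑ j, (Matrix.gram ℝ e)⁻¹ k j * inner ℝ (e j) w) • e k + inner ℝ ν w • ν := by
  refine sub_eq_zero.1 (hspan _ (fun i => ?_) ?_)
  · have h := congrFun (Matrix.mulVec_mulVec (fun j => inner ℝ (e j) w) (Matrix.gram ℝ e)
      (Matrix.gram ℝ e)⁻¹) i
    rw [Matrix.mul_nonsing_inv _ (Ne.isUnit hdet), Matrix.one_mulVec] at h
    simp only [Matrix.mulVec, dotProduct, Matrix.gram_apply] at h
    simp only [inner_sub_right, inner_add_right, inner_sum, inner_smul_right, hνe, mul_zero,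
      add_zero]
    rw [sub_eq_zero, ← h]
    exact Finset.sum_congr rfl fun k _ => mul_comm _ _
  · have hνe' : ∀ i, inner ℝ ν (e i) = (0 : ℝ) := fun i => by rw [real_inner_comm, hνe]
    simp [inner_sub_right, inner_add_right, inner_sum, inner_smul_right, hν, hνe']

end LinearAlgebra

/-- `F` is an immersion of class `C²` of the open set `U`, that is, a parametrized hypersurface.
Injectivity of the differential is encoded by the non-vanishing of the Gram determinant. -/
structure IsImmersionOn (F : E3 → E4) (U : Set E3) : Prop where
  isOpen : IsOpen U
  contDiffOn : ContDiffOn ℝ 2 F U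
  det_ne_zero : ∀ y ∈ U, (firstForm F y).det ≠ 0

lemma inner_cross_pd_self (F : E3 → E4) (y : E3) :
    inner ℝ (cross (pd 0 F y) (pd 1 F y) (pd 2 F y)) (cross (pd 0 F y) (pd 1 F y) (pd 2 F y)) =
      (firstForm F y).det :=
  inner_cross_self fun i => pd i F y

lemma norm_cross_pd (F : E3 → E4) (y : E3) :
    ‖cross (pd 0 F y) (pd 1 F y) (pd 2 F y)‖ = √(firstForm F y).det := by
  rw [← inner_cross_pd_self, norm_eq_sqrt_real_inner]

lemma inner_pd_unitNormal (F : E3 → E4) (y : E3) (i : Fin 3) :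
    inner ℝ (pd i F y) (unitNormal F y) = (0 : ℝ) := by
  rw [unitNormal, inner_smul_right, inner_cross_right (fun i => pd i F y) i, mul_zero]

lemma det4_pd_unitNormal (F : E3 → E4) (y : E3) :
    det4 (pd 0 F y) (pd 1 F y) (pd 2 F y) (unitNormal F y) = √(firstForm F y).det := by
  rw [← inner_cross, unitNormal, inner_smul_right, inner_cross_pd_self, norm_cross_pd,
    inv_mul_eq_div, Real.div_sqrt]

namespace IsImmersionOn

variable {F : E3 → E4} {U : Set E3} {y : E3} (hF : IsImmersionOn F U)
include hF

lemma det_firstForm_pos (hy : y ∈ U) : 0 < (firstForm F y).det := by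
  refine lt_of_le_of_ne ?_ (hF.det_ne_zero y hy).symm
  rw [← inner_cross_pd_self]
  exact real_inner_self_nonneg

lemma sqrt_det_firstForm_pos (hy : y ∈ U) : 0 < √(firstForm F y).det :=
  Real.sqrt_pos.2 (hF.det_firstForm_pos hy)

lemma norm_unitNormal (hy : y ∈ U) : ‖unitNormal F y‖ = 1 := by
  rw [unitNormal, norm_smul, norm_inv, norm_norm, norm_cross_pd]
  exact inv_mul_cancel₀ (hF.sqrt_det_firstForm_pos hy).ne'

lemma inner_unitNormal_self (hy : y ∈ U) :
    inner ℝ (unitNormal F y) (unitNormal F y) = (1 : ℝ) := by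
  rw [real_inner_self_eq_norm_sq, hF.norm_unitNormal hy, one_pow]

lemma eq_sum_smul_pd_add_smul_unitNormal (hy : y ∈ U) (w : E4) :
    w = ∑ k, (∑ j, (firstForm F y)⁻¹ k j * inner ℝ (pd j F y) w) • pd k F y +
      inner ℝ (unitNormal F y) w • unitNormal F y := by
  have hframe : det4 (pd 0 F y) (pd 1 F y) (pd 2 F y) (unitNormal F y) ≠ 0 := by
    rw [det4_pd_unitNormal]
    exact (hF.sqrt_det_firstForm_pos hy).ne'
  exact eq_sum_smul_add_inner_smul (e := fun i => pd i F y) (hF.det_ne_zero y hy)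
    (hF.norm_unitNormal hy) (inner_pd_unitNormal F y)
    (fun v hv hνv => eq_zero_of_inner_eq_zero hframe (hv 0) (hv 1) (hv 2) hνv) w

lemma contDiffAt (hy : y ∈ U) : ContDiffAt ℝ 2 F y :=
  hF.contDiffOn.contDiffAt (hF.isOpen.mem_nhds hy)

lemma contDiffOn_pd (i : Fin 3) : ContDiffOn ℝ 1 (pd i F) U :=
  Hypersurface.contDiffOn_pd hF.isOpen hF.contDiffOn (by norm_num) i

lemma differentiableAt (hy : y ∈ U) : DifferentiableAt ℝ F y :=
  (hF.contDiffAt hy).differentiableAt (by norm_num)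

lemma differentiableAt_pd (hy : y ∈ U) (i : Fin 3) : DifferentiableAt ℝ (pd i F) y :=
  ((hF.contDiffOn_pd i).contDiffAt (hF.isOpen.mem_nhds hy)).differentiableAt (by norm_num)

lemma contDiffOn_unitNormal : ContDiffOn ℝ 1 (unitNormal F) U := by
  have hpd : ∀ i a, ContDiffOn ℝ 1 (fun z => pd i F z a) U := fun i =>
    (contDiffOn_piLp 2).1 (hF.contDiffOn_pd i)
  have hcross : ContDiffOn ℝ 1 (fun z => cross (pd 0 F z) (pd 1 F z) (pd 2 F z)) U := by
    refine (contDiffOn_piLp 2).2 fun k => ?_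
    have _hpd0 := hpd 0
    have _hpd1 := hpd 1
    have _hpd2 := hpd 2
    simp only [ofLp_cross, det4_eq_laplace]
    fun_prop
  have hnorm : ∀ z ∈ U, ‖cross (pd 0 F z) (pd 1 F z) (pd 2 F z)‖ ≠ 0 := fun z hz => by
    rw [norm_cross_pd]
    exact (hF.sqrt_det_firstForm_pos hz).ne'
  exact ((hcross.norm ℝ fun z hz => norm_ne_zero_iff.1 (hnorm z hz)).inv hnorm).smul hcross

lemma differentiableAt_unitNormal (hy : y ∈ U) : DifferentiableAt ℝ (unitNormal F) y :=
  (hF.contDiffOn_unitNormal.contDiffAt (hF.isOpen.mem_nhds hy)).differentiableAt (by norm_num)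

lemma secondForm_symm (hy : y ∈ U) (i j : Fin 3) : secondForm F y i j = secondForm F y j i := by
  simp only [secondForm, Matrix.of_apply, pd_comm (i := i) (j := j) (hF.contDiffAt hy)]

lemma inner_pd_pd_unitNormal (hy : y ∈ U) (i j : Fin 3) :
    inner ℝ (pd j F y) (pd i (unitNormal F) y) = -secondForm F y i j := by
  have h : pd i (fun z => inner ℝ (pd j F z) (unitNormal F z)) y = 0 := by
    simp only [inner_pd_unitNormal, pd_const]
  rw [pd_inner (hF.differentiableAt_pd hy j) (hF.differentiableAt_unitNormal hy)] at h
  exact eq_neg_of_add_eq_zero_right h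

lemma inner_unitNormal_pd_unitNormal (hy : y ∈ U) (i : Fin 3) :
    inner ℝ (unitNormal F y) (pd i (unitNormal F) y) = (0 : ℝ) := by
  have hone : (fun z => inner ℝ (unitNormal F z) (unitNormal F z)) =ᶠ[𝓝 y] fun _ => (1 : ℝ) := by
    filter_upwards [hF.isOpen.mem_nhds hy] with z hz using hF.inner_unitNormal_self hz
  have h := pd_congr (i := i) hone
  rw [pd_const, pd_inner (hF.differentiableAt_unitNormal hy) (hF.differentiableAt_unitNormal hy),
    real_inner_comm] at h
  linarith

/-- The Weingarten equation. -/
lemma pd_unitNormal (hy : y ∈ U) (i : Fin 3) : pd i (unitNormal F) y =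
    ∑ k, (-((firstForm F y)⁻¹ * secondForm F y) k i) • pd k F y := by
  rw [hF.eq_sum_smul_pd_add_smul_unitNormal hy (pd i (unitNormal F) y),
    hF.inner_unitNormal_pd_unitNormal hy, zero_smul, add_zero]
  simp only [hF.inner_pd_pd_unitNormal hy, hF.secondForm_symm hy i, Matrix.mul_apply, mul_neg,
    Finset.sum_neg_distrib]

end IsImmersionOn

/-! ### The exterior derivative of the Minkowski 2-form -/

section ExteriorDerivative

variable {U : Set E3} {f : E3 → ℝ} {X ν α β : E3 → E4} {y : E3}

lemma pd_det4 (hX : DifferentiableAt ℝ X y) (hν : DifferentiableAt ℝ ν y) (i : Fin 3) (u v : E4) :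
    pd i (fun z => det4 (X z) (ν z) u v) y =
      det4 (pd i X y) (ν y) u v + det4 (X y) (pd i ν y) u v := by
  have hXν : ∀ k l, DifferentiableAt ℝ (fun z => X z k * ν z l) y := fun k l =>
    ((differentiableAt_piLp 2).1 hX k).mul ((differentiableAt_piLp 2).1 hν l)
  rw [← sum_det4_single_left (pd i X y), ← sum_det4_single_left (X y) (pd i ν y),
    funext fun z => (sum_det4_single_left (X z) (ν z) u v).symm]
  rw [pd_sum fun k _ => DifferentiableAt.fun_sum fun l _ => (hXν k l).mul_const _,
    ← Finset.sum_add_distrib]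
  refine Finset.sum_congr rfl fun k _ => ?_
  rw [pd_sum fun l _ => (hXν k l).mul_const _, ← Finset.sum_add_distrib]
  refine Finset.sum_congr rfl fun l _ => ?_
  rw [pd_mul (hXν k l) (by fun_prop), pd_const, pd_mul ((differentiableAt_piLp 2).1 hX k)
    ((differentiableAt_piLp 2).1 hν l), pd_apply hX, pd_apply hν]
  ring

lemma differentiableAt_det4 (hX : DifferentiableAt ℝ X y) (hν : DifferentiableAt ℝ ν y)
    (u v : E4) : DifferentiableAt ℝ (fun z => det4 (X z) (ν z) u v) y := by
  have _hX := (differentiableAt_piLp 2).1 hX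
  have _hν := (differentiableAt_piLp 2).1 hν
  simp only [det4_eq_laplace]
  fun_prop

lemma contDiffOn_det4 {n : ℕ∞ω} (hX : ContDiffOn ℝ n X U) (hν : ContDiffOn ℝ n ν U) (u v : E4) :
    ContDiffOn ℝ n (fun z => det4 (X z) (ν z) u v) U := by
  have _hX := (contDiffOn_piLp 2).1 hX
  have _hν := (contDiffOn_piLp 2).1 hν
  simp only [det4_eq_laplace]
  fun_prop

/-- The density, with respect to the standard volume form of `ℝ³`, of the exterior derivative of
the 2-form `f det (X, ν, dα, dβ)`. The form is expanded as `∑ f det (X, ν, eₐ, e_b) dαᵃ ∧ dβᵇ`, so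
that the definition only involves first derivatives of the data. -/
def extDerivDensity (f : E3 → ℝ) (X ν α β : E3 → E4) (y : E3) : ℝ :=
  ∑ a, ∑ b, jac (fun z => f z * det4 (X z) (ν z) (EuclideanSpace.single a 1)
    (EuclideanSpace.single b 1)) (fun z => α z a) (fun z => β z b) y

lemma extDerivDensity_eq_wedgeCoeff (hf : DifferentiableAt ℝ f y) (hX : DifferentiableAt ℝ X y)
    (hν : DifferentiableAt ℝ ν y) (hα : DifferentiableAt ℝ α y) (hβ : DifferentiableAt ℝ β y) :
    extDerivDensity f X ν α β y = wedgeCoeff fun i j k =>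
      pd i f y * det4 (X y) (ν y) (pd j α y) (pd k β y) +
        f y * (det4 (pd i X y) (ν y) (pd j α y) (pd k β y) +
          det4 (X y) (pd i ν y) (pd j α y) (pd k β y)) := by
  simp only [extDerivDensity, jac_eq_wedgeCoeff, ← wedgeCoeff_sum]
  congr 1
  ext i j k
  simp only [← sum_det4_single_right _ _ (pd j α y), Finset.mul_sum, ← Finset.sum_add_distrib]
  refine Finset.sum_congr rfl fun a _ => Finset.sum_congr rfl fun b _ => ?_
  rw [pd_mul hf (differentiableAt_det4 hX hν _ _), pd_det4 hX hν, pd_apply hα, pd_apply hβ]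
  ring

lemma extDerivDensity_congr {f' : E3 → ℝ} {X' ν' α' β' : E3 → E4} (hf : f =ᶠ[𝓝 y] f')
    (hX : X =ᶠ[𝓝 y] X') (hν : ν =ᶠ[𝓝 y] ν') (hα : α =ᶠ[𝓝 y] α') (hβ : β =ᶠ[𝓝 y] β') :
    extDerivDensity f X ν α β y = extDerivDensity f' X' ν' α' β' y := by
  refine Finset.sum_congr rfl fun a _ => Finset.sum_congr rfl fun b _ => jac_congr ?_ ?_ ?_
  · filter_upwards [hf, hX, hν] with z h₁ h₂ h₃
    rw [h₁, h₂, h₃]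
  · filter_upwards [hα] with z hz
    rw [hz]
  · filter_upwards [hβ] with z hz
    rw [hz]

lemma continuousOn_extDerivDensity (hU : IsOpen U) (hf : ContDiffOn ℝ 1 f U)
    (hX : ContDiffOn ℝ 1 X U) (hν : ContDiffOn ℝ 1 ν U) (hα : ContDiffOn ℝ 1 α U)
    (hβ : ContDiffOn ℝ 1 β U) : ContinuousOn (extDerivDensity f X ν α β) U :=
  continuousOn_finsetSum _ fun a _ => continuousOn_finsetSum _ fun b _ =>
    continuousOn_jac hU (hf.mul (contDiffOn_det4 hX hν _ _)) ((contDiffOn_piLp 2).1 hα a)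
      ((contDiffOn_piLp 2).1 hβ b)

lemma integrable_extDerivDensity (hU : IsOpen U) (hf : ContDiffOn ℝ 1 f U)
    (hc : HasCompactSupport f) (hfU : tsupport f ⊆ U) (hX : ContDiffOn ℝ 1 X U)
    (hν : ContDiffOn ℝ 1 ν U) (hα : ContDiffOn ℝ 1 α U) (hβ : ContDiffOn ℝ 1 β U) :
    Integrable (extDerivDensity f X ν α β) :=
  integrable_finsetSum _ fun a _ => integrable_finsetSum _ fun b _ =>
    integrable_jac hU (hf.mul (contDiffOn_det4 hX hν _ _)) hc.mul_right
      ((tsupport_mul_subset_left (f := f)).trans hfU) ((contDiffOn_piLp 2).1 hα a)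
      ((contDiffOn_piLp 2).1 hβ b)

lemma integral_extDerivDensity_eq_zero (hU : IsOpen U) (hf : ContDiffOn ℝ 1 f U)
    (hc : HasCompactSupport f) (hfU : tsupport f ⊆ U) (hX : ContDiffOn ℝ 1 X U)
    (hν : ContDiffOn ℝ 1 ν U) (hα : ContDiffOn ℝ 1 α U) (hβ : ContDiffOn ℝ 1 β U) :
    ∫ y, extDerivDensity f X ν α β y = 0 := by
  have hfc : ∀ a b : Fin 4, ContDiffOn ℝ 1 (fun z => f z * det4 (X z) (ν z)
      (EuclideanSpace.single a 1) (EuclideanSpace.single b 1)) U :=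
    fun a b => hf.mul (contDiffOn_det4 hX hν _ _)
  have hsub : ∀ a b : Fin 4, tsupport (fun z => f z * det4 (X z) (ν z)
      (EuclideanSpace.single a 1) (EuclideanSpace.single b 1)) ⊆ U :=
    fun a b => (tsupport_mul_subset_left (f := f)).trans hfU
  have hα' := (contDiffOn_piLp 2).1 hα
  have hβ' := (contDiffOn_piLp 2).1 hβ
  have hinteg := fun a b => integrable_jac hU (hfc a b) hc.mul_right (hsub a b) (hα' a) (hβ' b)
  unfold extDerivDensity
  rw [integral_finsetSum _ fun a _ => integrable_finsetSum _ fun b _ => hinteg a b]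
  refine Finset.sum_eq_zero fun a _ => ?_
  rw [integral_finsetSum _ fun b _ => hinteg a b]
  exact Finset.sum_eq_zero fun b _ =>
    integral_jac_eq_zero hU (hfc a b) hc.mul_right (hsub a b) (hα' a) (hβ' b)

end ExteriorDerivative

/-- The support function of the parametrized hypersurface `F`. -/
def supportFunction (F : E3 → E4) (y : E3) : ℝ := inner ℝ (F y) (unitNormal F y)

/-- The components, with respect to the coordinate frame, of the tangential part of the position
vector. -/
def tangentialCoord (F : E3 → E4) (y : E3) (k : Fin 3) : ℝ :=
  ∑ j, (firstForm F y)⁻¹ k j * inner ℝ (pd j F y) (F y)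

/-- The matrix of the shape operator with respect to the coordinate frame. -/
def shapeOperator (F : E3 → E4) (y : E3) : Matrix (Fin 3) (Fin 3) ℝ :=
  (firstForm F y)⁻¹ * secondForm F y

/-- The Ricci tensor of a hypersurface, according to the Gauss equation. -/
def gaussRicci (F : E3 → E4) (y : E3) : Matrix (Fin 3) (Fin 3) ℝ :=
  (shapeOperator F y).trace • secondForm F y - secondForm F y * shapeOperator F y

/-- The density of the exterior derivative of the 2-form
`η (det (X, ν, dX, dX) + p det (X, ν, dX, dν) + p² det (X, ν, dν, dν))`, where `p = ⟨X, ν⟩`. It is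
used for the position `X` and the unit normal `ν` of a hypersurface, so that `p` is the support
function, and a cut-off function `η`. -/
def minkowskiDensity (η : E3 → ℝ) (X ν : E3 → E4) (y : E3) : ℝ :=
  extDerivDensity η X ν X X y +
  extDerivDensity (fun z => η z * inner ℝ (X z) (ν z)) X ν X ν y +
  extDerivDensity (fun z => η z * inner ℝ (X z) (ν z) ^ 2) X ν ν ν y

/-- The vector with tangential components `a` and normal component `t` in the frame
`(∂₀F, ∂₁F, ∂₂F, ν)` of the parametrized hypersurface `F`. -/
def frameVec (F : E3 → E4) (y : E3) (a : Fin 3 → ℝ) (t : ℝ) : E4 :=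
  ∑ k, a k • pd k F y + t • unitNormal F y

lemma pd_eq_frameVec (F : E3 → E4) (y : E3) (i : Fin 3) :
    pd i F y = frameVec F y (Pi.single i 1) 0 := by
  simp [frameVec, Pi.single_apply]

lemma unitNormal_eq_frameVec (F : E3 → E4) (y : E3) : unitNormal F y = frameVec F y 0 1 := by
  simp [frameVec]

lemma det4_frameVec (F : E3 → E4) (y : E3) (a b c d : Fin 3 → ℝ) (p q r s : ℝ) :
    det4 (frameVec F y a p) (frameVec F y b q) (frameVec F y c r) (frameVec F y d s) =
      det4 !₂[a 0, a 1, a 2, p] !₂[b 0, b 1, b 2, q] !₂[c 0, c 1, c 2, r] !₂[d 0, d 1, d 2, s] *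
        √(firstForm F y).det := by
  have h := det4_sum_smul (Matrix.of ![![a 0, a 1, a 2, p], ![b 0, b 1, b 2, q],
    ![c 0, c 1, c 2, r], ![d 0, d 1, d 2, s]]) ![pd 0 F y, pd 1 F y, pd 2 F y, unitNormal F y]
  rw [← det4_pd_unitNormal]
  simpa [Fin.sum_univ_four, Fin.sum_univ_three, frameVec, add_assoc, det4] using h

namespace IsImmersionOn

variable {F : E3 → E4} {U : Set E3} {y : E3} (hF : IsImmersionOn F U)
include hF

lemma contDiffOn_supportFunction : ContDiffOn ℝ 1 (supportFunction F) U :=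
  (hF.contDiffOn.of_le (by norm_num)).inner ℝ hF.contDiffOn_unitNormal

lemma differentiableAt_supportFunction (hy : y ∈ U) : DifferentiableAt ℝ (supportFunction F) y :=
  (hF.contDiffOn_supportFunction.contDiffAt (hF.isOpen.mem_nhds hy)).differentiableAt (by norm_num)

lemma position_eq_frameVec (hy : y ∈ U) :
    F y = frameVec F y (tangentialCoord F y) (supportFunction F y) := by
  conv_lhs => rw [hF.eq_sum_smul_pd_add_smul_unitNormal hy (F y)]
  rw [real_inner_comm]
  rfl

lemma pd_unitNormal_eq_frameVec (hy : y ∈ U) (i : Fin 3) :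
    pd i (unitNormal F) y = frameVec F y (fun k => -shapeOperator F y k i) 0 := by
  rw [hF.pd_unitNormal hy, frameVec, zero_smul, add_zero]
  rfl

lemma firstForm_mul_shapeOperator (hy : y ∈ U) :
    firstForm F y * shapeOperator F y = secondForm F y :=
  Matrix.mul_nonsing_inv_cancel_left _ _ (hF.det_ne_zero y hy).isUnit

lemma pd_supportFunction (hy : y ∈ U) (i : Fin 3) :
    pd i (supportFunction F) y = -∑ k, tangentialCoord F y k * secondForm F y k i := by
  have hpd : pd i (supportFunction F) y = inner ℝ (F y) (pd i (unitNormal F) y) := by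
    unfold supportFunction
    rw [pd_inner (hF.differentiableAt hy) (hF.differentiableAt_unitNormal hy),
      inner_pd_unitNormal, zero_add]
  rw [hpd, hF.position_eq_frameVec hy, frameVec, inner_add_left, inner_smul_left,
    hF.inner_unitNormal_pd_unitNormal hy, sum_inner]
  simp [inner_smul_left, hF.inner_pd_pd_unitNormal hy, hF.secondForm_symm hy i]

lemma extDerivDensity_position_position (hy : y ∈ U) :
    extDerivDensity (fun _ => 1) F (unitNormal F) F F y =
      √(firstForm F y).det * (6 + 2 * supportFunction F y * (shapeOperator F y).trace) := by
  rw [extDerivDensity_eq_wedgeCoeff (by fun_prop) (hF.differentiableAt hy)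
    (hF.differentiableAt_unitNormal hy) (hF.differentiableAt hy) (hF.differentiableAt hy)]
  simp only [hF.position_eq_frameVec hy, hF.pd_unitNormal_eq_frameVec hy, pd_eq_frameVec,
    unitNormal_eq_frameVec, pd_const, det4_frameVec, wedgeCoeff, Matrix.trace_fin_three]
  simp [det4_eq_laplace]
  ring

lemma extDerivDensity_position_normal (hy : y ∈ U) :
    extDerivDensity (supportFunction F) F (unitNormal F) F (unitNormal F) y =
      √(firstForm F y).det * (tangentialCoord F y ⬝ᵥ (gaussRicci F y *ᵥ tangentialCoord F y) -
        2 * supportFunction F y * (shapeOperator F y).trace - supportFunction F y ^ 2 *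
          ((shapeOperator F y).trace ^ 2 - (shapeOperator F y * shapeOperator F y).trace)) := by
  rw [extDerivDensity_eq_wedgeCoeff (hF.differentiableAt_supportFunction hy)
    (hF.differentiableAt hy) (hF.differentiableAt_unitNormal hy) (hF.differentiableAt hy)
    (hF.differentiableAt_unitNormal hy)]
  simp only [hF.position_eq_frameVec hy, hF.pd_unitNormal_eq_frameVec hy, pd_eq_frameVec,
    unitNormal_eq_frameVec, hF.pd_supportFunction hy, det4_frameVec, wedgeCoeff, gaussRicci,
    Matrix.trace_fin_three, Matrix.mulVec, dotProduct, Matrix.sub_apply, Matrix.smul_apply,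
    Matrix.mul_apply, Fin.sum_univ_three, smul_eq_mul]
  simp [det4_eq_laplace]
  ring

lemma extDerivDensity_normal_normal (hy : y ∈ U) :
    extDerivDensity (fun z => supportFunction F z ^ 2) F (unitNormal F) (unitNormal F)
        (unitNormal F) y =
      √(firstForm F y).det * (supportFunction F y ^ 2 *
          ((shapeOperator F y).trace ^ 2 - (shapeOperator F y * shapeOperator F y).trace) +
        2 * supportFunction F y * (shapeOperator F y).det * (3 * supportFunction F y ^ 2 -
          2 * (tangentialCoord F y ⬝ᵥ (firstForm F y *ᵥ tangentialCoord F y)))) := by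
  rw [extDerivDensity_eq_wedgeCoeff ((hF.differentiableAt_supportFunction hy).fun_pow 2)
    (hF.differentiableAt hy) (hF.differentiableAt_unitNormal hy)
    (hF.differentiableAt_unitNormal hy) (hF.differentiableAt_unitNormal hy)]
  simp only [hF.position_eq_frameVec hy, hF.pd_unitNormal_eq_frameVec hy, pd_eq_frameVec,
    unitNormal_eq_frameVec, pd_pow_two (hF.differentiableAt_supportFunction hy),
    hF.pd_supportFunction hy, ← hF.firstForm_mul_shapeOperator hy, det4_frameVec,
    wedgeCoeff, Matrix.trace_fin_three, Matrix.det_fin_three (shapeOperator F y), Matrix.mulVec,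
    dotProduct, Matrix.mul_apply, Fin.sum_univ_three]
  simp [det4_eq_laplace]
  ring

lemma minkowskiDensity_one (hy : y ∈ U) : minkowskiDensity (fun _ => 1) F (unitNormal F) y =
    √(firstForm F y).det *
      (6 + tangentialCoord F y ⬝ᵥ (gaussRicci F y *ᵥ tangentialCoord F y) +
        2 * supportFunction F y * gaussKroneckerCoord F y * (3 * supportFunction F y ^ 2 -
          2 * (tangentialCoord F y ⬝ᵥ (firstForm F y *ᵥ tangentialCoord F y)))) := by
  have hK : gaussKroneckerCoord F y = (shapeOperator F y).det := rfl
  simp only [minkowskiDensity, one_mul]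
  change _ + extDerivDensity (supportFunction F) _ _ _ _ y +
    extDerivDensity (fun z => supportFunction F z ^ 2) _ _ _ _ y = _
  rw [hF.extDerivDensity_position_position hy, hF.extDerivDensity_position_normal hy,
    hF.extDerivDensity_normal_normal hy, hK]
  ring

end IsImmersionOn

/-! ### The Gauss equation -/

section WeakCurl

variable {ι : Type*} [Fintype ι] {A B : E3 → EuclideanSpace ℝ ι} {U : Set E3} {η : E3 → ℝ} {y : E3}

/-- The defect in the product rule for the curl of the covector field `⟨B, ∂ₖA⟩`. It vanishes
trivially when `A` is of class `C²`. -/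
def curlDefect (A B : E3 → EuclideanSpace ℝ ι) (k j : Fin 3) (y : E3) : ℝ :=
  inner ℝ (pd k B y) (pd j A y) - inner ℝ (pd j B y) (pd k A y) -
    (pd k (fun z => inner ℝ (B z) (pd j A z)) y - pd j (fun z => inner ℝ (B z) (pd k A z)) y)

lemma continuousOn_curlDefect (hU : IsOpen U) (hA : ContDiffOn ℝ 1 A U) (hB : ContDiffOn ℝ 1 B U)
    (hBA : ∀ j, ContDiffOn ℝ 1 (fun z => inner ℝ (B z) (pd j A z)) U) (k j : Fin 3) :
    ContinuousOn (curlDefect A B k j) U :=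
  have hA' := continuousOn_pd hU hA
  have hB' := continuousOn_pd hU hB
  (((hB' k).inner (hA' j)).sub ((hB' j).inner (hA' k))).sub
    ((continuousOn_pd hU (hBA j) k).sub (continuousOn_pd hU (hBA k) j))

lemma mul_curlDefect (hη : DifferentiableAt ℝ η y) (hA : DifferentiableAt ℝ A y)
    (hB : DifferentiableAt ℝ B y)
    (hBA : ∀ j, DifferentiableAt ℝ (fun z => inner ℝ (B z) (pd j A z)) y) (k j : Fin 3) :
    η y * curlDefect A B k j y =
      ∑ a, (pd k (fun z => η z * B z a) y * pd j (fun z => A z a) y -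
        pd j (fun z => η z * B z a) y * pd k (fun z => A z a) y) -
      (pd k (fun z => η z * inner ℝ (B z) (pd j A z)) y -
        pd j (fun z => η z * inner ℝ (B z) (pd k A z)) y) := by
  have hsum : ∀ k j, ∑ a, pd k (fun z => η z * B z a) y * pd j (fun z => A z a) y =
      pd k η y * inner ℝ (B y) (pd j A y) + η y * inner ℝ (pd k B y) (pd j A y) := by
    intro k j
    simp only [PiLp.inner_apply, Finset.mul_sum, ← Finset.sum_add_distrib]
    refine Finset.sum_congr rfl fun a _ => ?_
    rw [pd_mul hη ((differentiableAt_piLp 2).1 hB a), pd_apply hA, pd_apply hB]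
    simp
    ring
  rw [Finset.sum_sub_distrib, hsum, hsum, pd_mul hη (hBA j), pd_mul hη (hBA k), curlDefect]
  ring

lemma integral_mul_curlDefect_eq_zero (hU : IsOpen U) (hA : ContDiffOn ℝ 1 A U)
    (hB : ContDiffOn ℝ 1 B U) (hBA : ∀ j, ContDiffOn ℝ 1 (fun z => inner ℝ (B z) (pd j A z)) U)
    (hη : ContDiff ℝ 1 η) (hc : HasCompactSupport η) (hηU : tsupport η ⊆ U) (k j : Fin 3) :
    ∫ y, η y * curlDefect A B k j y = 0 := by
  have hsub : ∀ f : E3 → ℝ, tsupport (fun z => η z * f z) ⊆ U := fun _ =>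
    tsupport_mul_subset_left.trans hηU
  have hBη : ∀ a, ContDiffOn ℝ 1 (fun z => η z * B z a) U := fun a =>
    hη.contDiffOn.mul ((contDiffOn_piLp 2).1 hB a)
  have hAa := (contDiffOn_piLp 2).1 hA
  have hBAη : ∀ j, ContDiff ℝ 1 (fun z => η z * inner ℝ (B z) (pd j A z)) := fun j =>
    contDiff_of_contDiffOn_of_tsupport_subset hU (hη.contDiffOn.mul (hBA j))
      (hsub _)
  have heq : ∀ y, η y * curlDefect A B k j y = _ := fun y => by
    by_cases hy : y ∈ tsupport η
    · have hnhds := hU.mem_nhds (hηU hy)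
      exact mul_curlDefect (hη.differentiable one_ne_zero y)
        ((hA.contDiffAt hnhds).differentiableAt one_ne_zero)
        ((hB.contDiffAt hnhds).differentiableAt one_ne_zero)
        (fun j => ((hBA j).contDiffAt hnhds).differentiableAt one_ne_zero) k j
    · have hpd : ∀ (f : E3 → ℝ) m, pd m (fun z => η z * f z) y = 0 := fun f =>
        pd_eq_zero_of_notMem_tsupport fun h => hy (tsupport_mul_subset_left h)
      simp [hpd, image_eq_zero_of_notMem_tsupport hy]
  have hcurl := fun a => integrable_pd_mul_pd_sub hU (hBη a) hc.mul_right (hsub _) (hAa a) k j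
  have hdiv : ∀ k j, Integrable fun y => pd k (fun z => η z * inner ℝ (B z) (pd j A z)) y :=
    fun k j => integrable_pd (hBAη j) hc.mul_right k
  simp only [heq]
  rw [integral_sub (integrable_finsetSum _ fun a _ => hcurl a) ((hdiv k j).sub' (hdiv j k)),
    integral_finsetSum _ fun a _ => hcurl a, integral_sub (hdiv k j) (hdiv j k),
    integral_pd_eq_zero (hBAη j) hc.mul_right, integral_pd_eq_zero (hBAη k) hc.mul_right,
    Finset.sum_eq_zero fun a _ =>
      integral_pd_mul_pd_sub_eq_zero hU (hBη a) hc.mul_right (hsub _) (hAa a) k j]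
  simp

lemma curlDefect_eq_zero (hU : IsOpen U) (hA : ContDiffOn ℝ 1 A U) (hB : ContDiffOn ℝ 1 B U)
    (hBA : ∀ j, ContDiffOn ℝ 1 (fun z => inner ℝ (B z) (pd j A z)) U) (hy : y ∈ U)
    (k j : Fin 3) : curlDefect A B k j y = 0 := by
  have hcont := continuousOn_curlDefect hU hA hB hBA k j
  have hae := hU.ae_eq_zero_of_integral_contDiff_smul_eq_zero
    (hcont.locallyIntegrableOn (μ := volume) hU.measurableSet) fun η hη hc hηU =>
      integral_mul_curlDefect_eq_zero hU hA hB hBA (hη.of_le (by simp)) hc hηU k j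
  exact Measure.eqOn_open_of_ae_eq ((ae_restrict_iff' hU.measurableSet).2 hae) hU hcont
    continuousOn_const hy

end WeakCurl

section Curvature

variable {G G' : E3 → Matrix (Fin 3) (Fin 3) ℝ} {y : E3}

/-- The coefficient `Rᵐᵢₖⱼ` of the Riemann tensor of a metric with coefficient matrix `G`, whose
contraction over `m = k` is the Ricci tensor. -/
def riemannCoeff (G : E3 → Matrix (Fin 3) (Fin 3) ℝ) (m i k j : Fin 3) (y : E3) : ℝ :=
  pd k (christoffel G m i j) y - pd j (christoffel G m i k) y +
    ∑ q, (christoffel G m k q y * christoffel G q i j y -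
      christoffel G m j q y * christoffel G q i k y)

lemma ricciCoeff_eq_sum_riemannCoeff (G : E3 → Matrix (Fin 3) (Fin 3) ℝ) (i j : Fin 3) (y : E3) :
    ricciCoeff G i j y = ∑ k, riemannCoeff G k i k j y :=
  Finset.sum_add_distrib.symm

lemma christoffel_congr (h : G =ᶠ[𝓝 y] G') (k i j : Fin 3) :
    christoffel G k i j =ᶠ[𝓝 y] christoffel G' k i j := by
  have hpd : ∀ᶠ z in 𝓝 y, ∀ a i j, pd a (fun z => G z i j) z = pd a (fun z => G' z i j) z := by
    simp only [eventually_all]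
    exact fun a i j => pd_eventuallyEq (h.fun_comp fun A => A i j)
  filter_upwards [h, hpd] with z hz hpdz
  simp only [christoffel, hz, hpdz]

lemma ricciCoeff_congr (h : G =ᶠ[𝓝 y] G') (i j : Fin 3) :
    ricciCoeff G i j y = ricciCoeff G' i j y := by
  have hΓ := christoffel_congr h
  simp only [ricciCoeff, pd_congr (hΓ _ _ _), (hΓ _ _ _).eq_of_nhds]

lemma contDiffOn_matrix_inv_apply {n : ℕ∞ω} {U : Set E3}
    (hG : ∀ i j, ContDiffOn ℝ n (fun z => G z i j) U) (hdet : ∀ z ∈ U, (G z).det ≠ 0)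
    (k l : Fin 3) : ContDiffOn ℝ n (fun z => (G z)⁻¹ k l) U := by
  have hdet' : ContDiffOn ℝ n (fun z => (G z).det) U := by
    simp only [Matrix.det_fin_three]
    fun_prop
  simp only [Matrix.inv_def, Ring.inverse_eq_inv', Matrix.smul_apply, smul_eq_mul]
  refine (hdet'.inv hdet).mul ?_
  simp only [Matrix.adjugate_fin_three]
  fin_cases k <;> fin_cases l <;>
    simp only [Fin.isValue, Fin.zero_eta, Fin.mk_one, Fin.reduceFinMk, Matrix.of_apply,
      Matrix.cons_val', Matrix.cons_val_zero, Matrix.cons_val_one, Matrix.cons_val,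
      Matrix.cons_val_fin_one] <;>
    fun_prop

end Curvature

namespace IsImmersionOn

variable {F : E3 → E4} {U : Set E3} {y : E3} (hF : IsImmersionOn F U)
include hF

lemma pd_firstForm (hy : y ∈ U) (k i j : Fin 3) : pd k (fun z => firstForm F z i j) y =
    inner ℝ (pd j F y) (pd k (pd i F) y) + inner ℝ (pd i F y) (pd k (pd j F) y) := by
  simp only [firstForm, Matrix.of_apply]
  rw [pd_inner (hF.differentiableAt_pd hy i) (hF.differentiableAt_pd hy j),
    real_inner_comm (pd k (pd i F) y)]

lemma inner_pd_pd_pd_eq (hy : y ∈ U) (i j l : Fin 3) :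
    inner ℝ (pd l F y) (pd i (pd j F) y) = (1 / 2) * (pd i (fun z => firstForm F z j l) y +
      pd j (fun z => firstForm F z i l) y - pd l (fun z => firstForm F z i j) y) := by
  have hcomm : ∀ a b, pd a (pd b F) y = pd b (pd a F) y := fun _ _ => pd_comm (hF.contDiffAt hy)
  simp only [hF.pd_firstForm hy]
  rw [hcomm j i, hcomm l i, hcomm l j]
  ring

lemma christoffel_firstForm (hy : y ∈ U) (k i j : Fin 3) : christoffel (firstForm F) k i j y =
    ∑ l, (firstForm F y)⁻¹ k l * inner ℝ (pd l F y) (pd i (pd j F) y) := by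
  rw [christoffel, Finset.mul_sum]
  refine Finset.sum_congr rfl fun l _ => ?_
  rw [hF.inner_pd_pd_pd_eq hy]
  ring

/-- The Gauss formula. -/
lemma pd_pd_eq (hy : y ∈ U) (i j : Fin 3) : pd i (pd j F) y =
    ∑ k, christoffel (firstForm F) k i j y • pd k F y +
      secondForm F y i j • unitNormal F y := by
  conv_lhs => rw [hF.eq_sum_smul_pd_add_smul_unitNormal hy (pd i (pd j F) y)]
  simp only [hF.christoffel_firstForm hy, secondForm, Matrix.of_apply]
  rw [real_inner_comm (unitNormal F y)]

lemma inner_pd_pd_eq (hy : y ∈ U) (i j : Fin 3) (w : E4) :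
    inner ℝ w (pd i (pd j F) y) = ∑ m, christoffel (firstForm F) m i j y * inner ℝ w (pd m F y) +
      secondForm F y i j * inner ℝ w (unitNormal F y) := by
  conv_lhs => rw [hF.pd_pd_eq hy i j]
  simp only [inner_add_right, inner_sum, inner_smul_right]

lemma inner_pd_pd_pd_eq_sum_christoffel (hy : y ∈ U) (i j l : Fin 3) :
    inner ℝ (pd l F y) (pd i (pd j F) y) =
      ∑ m, christoffel (firstForm F) m i j y * firstForm F y l m := by
  rw [hF.inner_pd_pd_eq hy, inner_pd_unitNormal, mul_zero, add_zero]
  rfl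

lemma inner_pd_pd_pd_pd (hy : y ∈ U) (i j k l : Fin 3) :
    inner ℝ (pd k (pd l F) y) (pd i (pd j F) y) =
      ∑ m, christoffel (firstForm F) m i j y * inner ℝ (pd m F y) (pd k (pd l F) y) +
        secondForm F y i j * secondForm F y k l := by
  rw [hF.inner_pd_pd_eq hy]
  simp only [real_inner_comm (pd k (pd l F) y) (pd _ F y)]
  rfl

variable (hG : ∀ i j, ContDiffOn ℝ 2 (fun z => firstForm F z i j) U)
include hG

lemma contDiffOn_inner_pd_pd_pd (i j l : Fin 3) :
    ContDiffOn ℝ 1 (fun z => inner ℝ (pd l F z) (pd i (pd j F) z)) U := by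
  have hpd : ∀ a i j, ContDiffOn ℝ 1 (pd a (fun z => firstForm F z i j)) U := fun a i j =>
    Hypersurface.contDiffOn_pd hF.isOpen (hG i j) (by norm_num) a
  exact (contDiffOn_const.mul (((hpd i j l).add (hpd j i l)).sub (hpd l i j))).congr
    fun z hz => hF.inner_pd_pd_pd_eq hz i j l

lemma differentiableAt_christoffel (hy : y ∈ U) (k i j : Fin 3) :
    DifferentiableAt ℝ (christoffel (firstForm F) k i j) y := by
  have hinv := contDiffOn_matrix_inv_apply (fun i j => (hG i j).of_le one_le_two) hF.det_ne_zero
  have hΓ : ContDiffOn ℝ 1 (christoffel (firstForm F) k i j) U :=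
    (ContDiffOn.sum fun l _ => (hinv k l).mul (hF.contDiffOn_inner_pd_pd_pd hG i j l)).congr
      fun z hz => hF.christoffel_firstForm hz k i j
  exact (hΓ.contDiffAt (hF.isOpen.mem_nhds hy)).differentiableAt (by norm_num)

lemma pd_inner_pd_pd_pd (hy : y ∈ U) (k i j l : Fin 3) :
    pd k (fun z => inner ℝ (pd l F z) (pd i (pd j F) z)) y =
      ∑ m, (pd k (christoffel (firstForm F) m i j) y * firstForm F y l m +
        christoffel (firstForm F) m i j y * (inner ℝ (pd m F y) (pd k (pd l F) y) +
          inner ℝ (pd l F y) (pd k (pd m F) y))) := by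
  have hΓ := fun m => hF.differentiableAt_christoffel hG hy m i j
  have hGd : ∀ m, DifferentiableAt ℝ (fun z => firstForm F z l m) y := fun m =>
    ((hG l m).contDiffAt (hF.isOpen.mem_nhds hy)).differentiableAt (by norm_num)
  have hsum : (fun z => inner ℝ (pd l F z) (pd i (pd j F) z)) =ᶠ[𝓝 y]
      fun z => ∑ m, christoffel (firstForm F) m i j z * firstForm F z l m := by
    filter_upwards [hF.isOpen.mem_nhds hy] with z hz
    exact hF.inner_pd_pd_pd_eq_sum_christoffel hz i j l
  rw [pd_congr hsum, pd_sum fun m _ => (hΓ m).fun_mul (hGd m)]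
  refine Finset.sum_congr rfl fun m _ => ?_
  rw [pd_mul (hΓ m) (hGd m), hF.pd_firstForm hy]

/-- For an immersion of class `C³` this is the symmetry of third derivatives. In class `C²` it
holds in the sense of distributions, hence pointwise, because both sides are continuous as soon as
the first fundamental form is of class `C²`. -/
lemma pd_inner_pd_pd_pd_sub (hy : y ∈ U) (i j k l : Fin 3) :
    pd k (fun z => inner ℝ (pd l F z) (pd i (pd j F) z)) y -
      pd j (fun z => inner ℝ (pd l F z) (pd i (pd k F) z)) y =
    inner ℝ (pd k (pd l F) y) (pd i (pd j F) y) -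
      inner ℝ (pd j (pd l F) y) (pd i (pd k F) y) := by
  have hcomm : ∀ j, EqOn (pd j (pd i F)) (pd i (pd j F)) U := fun j z hz =>
    pd_comm (hF.contDiffAt hz)
  have hinner : ∀ j, EqOn (fun z => inner ℝ (pd l F z) (pd j (pd i F) z))
      (fun z => inner ℝ (pd l F z) (pd i (pd j F) z)) U := fun j z hz => by
    simp only [hcomm j hz]
  have hdefect := curlDefect_eq_zero hF.isOpen (hF.contDiffOn_pd i) (hF.contDiffOn_pd l)
    (fun j => (hF.contDiffOn_inner_pd_pd_pd hG i j l).congr (hinner j)) hy k j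
  rw [curlDefect, pd_congr ((hinner j).eventuallyEq_of_mem (hF.isOpen.mem_nhds hy)),
    pd_congr ((hinner k).eventuallyEq_of_mem (hF.isOpen.mem_nhds hy)), hcomm j hy,
    hcomm k hy] at hdefect
  exact (sub_eq_zero.1 hdefect).symm

lemma sum_firstForm_mul_riemannCoeff (hy : y ∈ U) (i j k l : Fin 3) :
    ∑ m, firstForm F y l m * riemannCoeff (firstForm F) m i k j y =
      secondForm F y i j * secondForm F y k l - secondForm F y i k * secondForm F y j l := by
  have h := hF.pd_inner_pd_pd_pd_sub hG hy i j k l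
  rw [hF.pd_inner_pd_pd_pd hG hy, hF.pd_inner_pd_pd_pd hG hy, hF.inner_pd_pd_pd_pd hy,
    hF.inner_pd_pd_pd_pd hy] at h
  simp only [hF.inner_pd_pd_pd_eq_sum_christoffel hy _ _ l] at h
  simp only [riemannCoeff, Fin.sum_univ_three] at h ⊢
  linear_combination h

/-- The Gauss equation. -/
theorem riemannCoeff_firstForm (hy : y ∈ U) (m i k j : Fin 3) :
    riemannCoeff (firstForm F) m i k j y =
      secondForm F y i j * shapeOperator F y m k - secondForm F y i k * shapeOperator F y m j := by
  suffices h : (fun m => riemannCoeff (firstForm F) m i k j y -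
      (secondForm F y i j * shapeOperator F y m k - secondForm F y i k * shapeOperator F y m j)) = 0
    from sub_eq_zero.1 (congrFun h m)
  refine Matrix.eq_zero_of_mulVec_eq_zero (hF.det_ne_zero y hy) ?_
  have hh := hF.firstForm_mul_shapeOperator hy
  ext l
  have hhl : ∀ k, ∑ m, firstForm F y l m * shapeOperator F y m k = secondForm F y k l := fun k => by
    rw [← Matrix.mul_apply, hh, hF.secondForm_symm hy]
  have h := hF.sum_firstForm_mul_riemannCoeff hG hy i j k l
  rw [← hhl k, ← hhl j] at h
  simp only [Matrix.mulVec, dotProduct, Fin.sum_univ_three] at h ⊢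
  rw [Pi.zero_apply]
  linear_combination h

theorem ricciCoeff_firstForm (hy : y ∈ U) (i j : Fin 3) :
    ricciCoeff (firstForm F) i j y = gaussRicci F y i j := by
  simp only [ricciCoeff_eq_sum_riemannCoeff, hF.riemannCoeff_firstForm hG hy,
    Finset.sum_sub_distrib, ← Finset.mul_sum, gaussRicci, Matrix.sub_apply, Matrix.smul_apply,
    Matrix.mul_apply, Matrix.trace, Matrix.diag_apply, smul_eq_mul, mul_comm]

end IsImmersionOn

/-! ### Changes of parameters -/

section Density

variable {U : Set E3} {f η η' : E3 → ℝ} {X X' ν ν' α β : E3 → E4} {y : E3}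

lemma extDerivDensity_const_mul (c : ℝ) :
    extDerivDensity (fun z => c * f z) X ν α β y = c * extDerivDensity f X ν α β y := by
  simp only [extDerivDensity, jac_eq_wedgeCoeff, wedgeCoeff, mul_assoc, pd_const_mul,
    Finset.mul_sum]
  exact Finset.sum_congr rfl fun a _ => Finset.sum_congr rfl fun b _ => by ring

lemma extDerivDensity_smul_second (c : ℝ) :
    extDerivDensity f X (fun z => c • ν z) α β y = c * extDerivDensity f X ν α β y := by
  have hdet : ∀ z u v, f z * det4 (X z) (c • ν z) u v = c * (f z * det4 (X z) (ν z) u v) :=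
    fun z u v => by
      simp only [det4_eq_laplace, PiLp.smul_apply, smul_eq_mul]
      ring
  rw [← extDerivDensity_const_mul]
  simp only [extDerivDensity, hdet, mul_assoc]

lemma extDerivDensity_smul_third (c : ℝ) :
    extDerivDensity f X ν (fun z => c • α z) β y = c * extDerivDensity f X ν α β y := by
  simp only [extDerivDensity, jac_eq_wedgeCoeff, wedgeCoeff, PiLp.smul_apply, smul_eq_mul,
    pd_const_mul, Finset.mul_sum]
  exact Finset.sum_congr rfl fun a _ => Finset.sum_congr rfl fun b _ => by ring

lemma extDerivDensity_smul_fourth (c : ℝ) :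
    extDerivDensity f X ν α (fun z => c • β z) y = c * extDerivDensity f X ν α β y := by
  simp only [extDerivDensity, jac_eq_wedgeCoeff, wedgeCoeff, PiLp.smul_apply, smul_eq_mul,
    pd_const_mul, Finset.mul_sum]
  exact Finset.sum_congr rfl fun a _ => Finset.sum_congr rfl fun b _ => by ring

lemma extDerivDensity_sum {ι : Type*} {s : Finset ι} {f : ι → E3 → ℝ}
    (hf : ∀ a ∈ s, DifferentiableAt ℝ (f a) y) (hX : DifferentiableAt ℝ X y)
    (hν : DifferentiableAt ℝ ν y) :
    extDerivDensity (fun z => ∑ a ∈ s, f a z) X ν α β y =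
      ∑ a ∈ s, extDerivDensity (f a) X ν α β y := by
  have hpd : ∀ i u v, pd i (fun z => (∑ a ∈ s, f a z) * det4 (X z) (ν z) u v) y =
      ∑ a ∈ s, pd i (fun z => f a z * det4 (X z) (ν z) u v) y := fun i u v => by
    simp only [Finset.sum_mul]
    exact pd_sum fun a ha => (hf a ha).mul (differentiableAt_det4 hX hν u v)
  simp only [extDerivDensity, jac_eq_wedgeCoeff, hpd]
  simp only [Finset.sum_mul, wedgeCoeff_sum]
  rw [Finset.sum_comm_cycle]

lemma minkowskiDensity_congr (hη : η =ᶠ[𝓝 y] η') (hX : X =ᶠ[𝓝 y] X') (hν : ν =ᶠ[𝓝 y] ν') :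
    minkowskiDensity η X ν y = minkowskiDensity η' X' ν' y := by
  have hp (k : ℕ) : (fun z => η z * (inner ℝ (X z) (ν z) : ℝ) ^ k) =ᶠ[𝓝 y]
      fun z => η' z * inner ℝ (X' z) (ν' z) ^ k := by
    filter_upwards [hη, hX, hν] with z hηz hXz hνz
    rw [hηz, hXz, hνz]
  have hp1 := hp 1
  simp only [pow_one] at hp1
  rw [minkowskiDensity, extDerivDensity_congr hη hX hν hX hX,
    extDerivDensity_congr hp1 hX hν hX hν, extDerivDensity_congr (hp 2) hX hν hν hν,
    minkowskiDensity]

lemma minkowskiDensity_smul_normal {s : ℝ} (hs : s ^ 2 = 1) :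
    minkowskiDensity η X (fun z => s • ν z) y = s * minkowskiDensity η X ν y := by
  simp only [minkowskiDensity, inner_smul_right, mul_pow, hs, one_mul, mul_left_comm _ s,
    extDerivDensity_const_mul, extDerivDensity_smul_second, extDerivDensity_smul_third,
    extDerivDensity_smul_fourth]
  linear_combination s * (extDerivDensity (fun z => η z * inner ℝ (X z) (ν z)) X ν X ν y +
    extDerivDensity (fun z => η z * inner ℝ (X z) (ν z) ^ 2) X ν ν ν y) * hs

lemma minkowskiDensity_eq_zero (hη : η =ᶠ[𝓝 y] fun _ => 0) : minkowskiDensity η X ν y = 0 := by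
  have hzero (α β : E3 → E4) : extDerivDensity (fun _ => 0) X ν α β y = 0 := by
    simpa using extDerivDensity_const_mul (f := fun _ => 0) (X := X) (ν := ν) (α := α) (β := β) 0
  rw [minkowskiDensity_congr hη .rfl .rfl]
  simp only [minkowskiDensity, zero_mul, hzero, add_zero]

lemma minkowskiDensity_sum {ι : Type*} {s : Finset ι} {η : ι → E3 → ℝ}
    (hη : ∀ a ∈ s, DifferentiableAt ℝ (η a) y) (hX : DifferentiableAt ℝ X y)
    (hν : DifferentiableAt ℝ ν y) :
    minkowskiDensity (fun z => ∑ a ∈ s, η a z) X ν y = ∑ a ∈ s, minkowskiDensity (η a) X ν y := by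
  have hp : DifferentiableAt ℝ (fun z => (inner ℝ (X z) (ν z) : ℝ)) y := hX.inner ℝ hν
  simp only [minkowskiDensity, Finset.sum_mul, Finset.sum_add_distrib]
  rw [extDerivDensity_sum hη hX hν, extDerivDensity_sum (fun a ha => (hη a ha).fun_mul hp) hX hν,
    extDerivDensity_sum (fun a ha => (hη a ha).fun_mul (hp.fun_pow 2)) hX hν]

lemma continuousOn_minkowskiDensity (hU : IsOpen U) (hη : ContDiffOn ℝ 1 η U)
    (hX : ContDiffOn ℝ 1 X U) (hν : ContDiffOn ℝ 1 ν U) :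
    ContinuousOn (minkowskiDensity η X ν) U :=
  have hp := hX.inner ℝ hν
  ((continuousOn_extDerivDensity hU hη hX hν hX hX).add
    (continuousOn_extDerivDensity hU (hη.mul hp) hX hν hX hν)).add
    (continuousOn_extDerivDensity hU (hη.mul (hp.pow 2)) hX hν hν hν)

lemma integral_minkowskiDensity_eq_zero (hU : IsOpen U) (hη : ContDiffOn ℝ 1 η U)
    (hc : HasCompactSupport η) (hηU : tsupport η ⊆ U) (hX : ContDiffOn ℝ 1 X U)
    (hν : ContDiffOn ℝ 1 ν U) : ∫ y, minkowskiDensity η X ν y = 0 := by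
  have hp := hX.inner ℝ hν
  have hsub : ∀ f : E3 → ℝ, tsupport (fun z => η z * f z) ⊆ U := fun _ =>
    tsupport_mul_subset_left.trans hηU
  have hinteg := integrable_extDerivDensity hU hη hc hηU hX hν hX hX
  have hinteg' := integrable_extDerivDensity hU (hη.mul hp) hc.mul_right (hsub _) hX hν hX hν
  have hinteg'' :=
    integrable_extDerivDensity hU (hη.mul (hp.pow 2)) hc.mul_right (hsub _) hX hν hν hν
  unfold minkowskiDensity
  rw [integral_add (hinteg.fun_add hinteg') hinteg'', integral_add hinteg hinteg',
    integral_extDerivDensity_eq_zero hU hη hc hηU hX hν hX hX,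
    integral_extDerivDensity_eq_zero hU (hη.mul hp) hc.mul_right (hsub _) hX hν hX hν,
    integral_extDerivDensity_eq_zero hU (hη.mul (hp.pow 2)) hc.mul_right (hsub _) hX hν hν hν,
    add_zero, add_zero]

end Density

section Reparametrization

/-- The Jacobian matrix of `τ`, with the derivatives in the direction of the `i`-th coordinate in
the `i`-th row. -/
def jacMatrix (τ : E3 → E3) (y : E3) : Matrix (Fin 3) (Fin 3) ℝ :=
  Matrix.of fun i a => pd i τ y a

lemma sqrt_det_mul_mul_transpose (J G : Matrix (Fin 3) (Fin 3) ℝ) :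
    √(J * G * Jᵀ).det = |J.det| * √G.det := by
  rw [Matrix.det_mul, Matrix.det_mul, Matrix.det_transpose, mul_right_comm, ← sq,
    Real.sqrt_mul (sq_nonneg _), Real.sqrt_sq_eq_abs]

lemma cross_sum_smul (J : Matrix (Fin 3) (Fin 3) ℝ) (e : Fin 3 → E4) :
    cross (∑ a, J 0 a • e a) (∑ a, J 1 a • e a) (∑ a, J 2 a • e a) =
      J.det • cross (e 0) (e 1) (e 2) := by
  ext k
  simp only [PiLp.smul_apply, ofLp_cross, det4_eq_laplace, Fin.sum_univ_three,
    Matrix.det_fin_three, PiLp.add_apply, smul_eq_mul]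
  ring

section Composition

variable {τ : E3 → E3} {y : E3}

lemma pd_comp {V : Type*} [NormedAddCommGroup V] [NormedSpace ℝ V] {f : E3 → V}
    (hτ : DifferentiableAt ℝ τ y) (hf : DifferentiableAt ℝ f (τ y)) (i : Fin 3) :
    pd i (fun z => f (τ z)) y = ∑ a, jacMatrix τ y i a • pd a f (τ y) := by
  have hcomp : pd i (fun z => f (τ z)) y = fderiv ℝ f (τ y) (pd i τ y) :=
    congrArg (fun L : E3 →L[ℝ] V => L (stdVec i)) (fderiv_comp y hf hτ)
  rw [hcomp]
  conv_lhs => rw [eq_sum_smul_stdVec (pd i τ y)]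
  simp only [map_sum, map_smul, jacMatrix, Matrix.of_apply, pd]

lemma jac_comp {u v w : E3 → ℝ} (hτ : DifferentiableAt ℝ τ y) (hu : DifferentiableAt ℝ u (τ y))
    (hv : DifferentiableAt ℝ v (τ y)) (hw : DifferentiableAt ℝ w (τ y)) :
    jac (fun z => u (τ z)) (fun z => v (τ z)) (fun z => w (τ z)) y =
      (jacMatrix τ y).det * jac u v w (τ y) := by
  simp only [jac_eq_wedgeCoeff, wedgeCoeff, pd_comp hτ hu, pd_comp hτ hv, pd_comp hτ hw,
    Matrix.det_fin_three, Fin.sum_univ_three, smul_eq_mul]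
  ring

variable {f η : E3 → ℝ} {X ν α β : E3 → E4}

lemma extDerivDensity_comp (hτ : DifferentiableAt ℝ τ y) (hf : DifferentiableAt ℝ f (τ y))
    (hX : DifferentiableAt ℝ X (τ y)) (hν : DifferentiableAt ℝ ν (τ y))
    (hα : DifferentiableAt ℝ α (τ y)) (hβ : DifferentiableAt ℝ β (τ y)) :
    extDerivDensity (fun z => f (τ z)) (fun z => X (τ z)) (fun z => ν (τ z)) (fun z => α (τ z))
      (fun z => β (τ z)) y = (jacMatrix τ y).det * extDerivDensity f X ν α β (τ y) := by
  simp only [extDerivDensity, Finset.mul_sum]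
  exact Finset.sum_congr rfl fun a _ => Finset.sum_congr rfl fun b _ =>
    jac_comp (u := fun z => f z * det4 (X z) (ν z) (.single a 1) (.single b 1))
      (v := fun z => α z a) (w := fun z => β z b) hτ (hf.fun_mul (differentiableAt_det4 hX hν _ _))
      ((differentiableAt_piLp 2).1 hα a) ((differentiableAt_piLp 2).1 hβ b)

lemma minkowskiDensity_comp (hτ : DifferentiableAt ℝ τ y) (hη : DifferentiableAt ℝ η (τ y))
    (hX : DifferentiableAt ℝ X (τ y)) (hν : DifferentiableAt ℝ ν (τ y)) :
    minkowskiDensity (fun z => η (τ z)) (fun z => X (τ z)) (fun z => ν (τ z)) y =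
      (jacMatrix τ y).det * minkowskiDensity η X ν (τ y) := by
  have hp : DifferentiableAt ℝ (fun z => (inner ℝ (X z) (ν z) : ℝ)) (τ y) := hX.inner ℝ hν
  have hηp := extDerivDensity_comp hτ (hη.fun_mul hp) hX hν hX hν
  have hηp2 := extDerivDensity_comp hτ (hη.fun_mul (hp.fun_pow 2)) hX hν hν hν
  rw [minkowskiDensity, hηp, hηp2, extDerivDensity_comp hτ hη hX hν hX hX, minkowskiDensity]
  ring

end Composition

lemma gaussKroneckerCoord_eq_div (F : E3 → E4) (y : E3) :
    gaussKroneckerCoord F y = (secondForm F y).det / (firstForm F y).det := by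
  rw [gaussKroneckerCoord, Matrix.det_mul, Matrix.det_nonsing_inv, Ring.inverse_eq_inv',
    inv_mul_eq_div]

lemma coe_sign_sq {x : ℝ} (hx : x ≠ 0) : (SignType.sign x : ℝ) ^ 2 = 1 := by
  rcases hx.lt_or_gt with hneg | hpos
  · simp [sign_neg hneg]
  · simp [sign_pos hpos]

/-- `F'` is obtained from `F` by the change of parameters `τ`. -/
structure IsReparametrization (F : E3 → E4) (U : Set E3) (F' : E3 → E4) (V : Set E3)
    (τ : E3 → E3) : Prop where
  left : IsImmersionOn F U
  right : IsImmersionOn F' V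
  contDiffOn : ContDiffOn ℝ 1 τ V
  mapsTo : MapsTo τ V U
  eqOn : EqOn F' (F ∘ τ) V

namespace IsReparametrization

variable {F F' : E3 → E4} {U V : Set E3} {τ : E3 → E3} {y : E3}
  (h : IsReparametrization F U F' V τ)
include h

lemma differentiableAt (hy : y ∈ V) : DifferentiableAt ℝ τ y :=
  (h.contDiffOn.contDiffAt (h.right.isOpen.mem_nhds hy)).differentiableAt one_ne_zero

lemma eventuallyEq (hy : y ∈ V) : F' =ᶠ[𝓝 y] fun z => F (τ z) :=
  h.eqOn.eventuallyEq_of_mem (h.right.isOpen.mem_nhds hy)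

lemma pd_eq (hy : y ∈ V) (i : Fin 3) :
    pd i F' y = ∑ a, jacMatrix τ y i a • pd a F (τ y) := by
  rw [pd_congr (h.eventuallyEq hy), pd_comp (h.differentiableAt hy)
    (h.left.differentiableAt (h.mapsTo hy))]

lemma firstForm_eq (hy : y ∈ V) :
    firstForm F' y = jacMatrix τ y * firstForm F (τ y) * (jacMatrix τ y)ᵀ := by
  ext i j
  simp only [firstForm, Matrix.of_apply, h.pd_eq hy, Matrix.mul_apply, Matrix.transpose_apply,
    Fin.sum_univ_three, inner_add_left, inner_add_right, inner_smul_left, inner_smul_right,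
    RCLike.conj_to_real]
  ring

lemma det_firstForm_eq (hy : y ∈ V) :
    (firstForm F' y).det = (jacMatrix τ y).det ^ 2 * (firstForm F (τ y)).det := by
  rw [h.firstForm_eq hy, Matrix.det_mul, Matrix.det_mul, Matrix.det_transpose]
  ring

lemma det_jacMatrix_ne_zero (hy : y ∈ V) : (jacMatrix τ y).det ≠ 0 := fun hdet =>
  h.right.det_ne_zero y hy (by rw [h.det_firstForm_eq hy, hdet, sq, zero_mul, zero_mul])

lemma sqrt_det_firstForm_eq (hy : y ∈ V) :
    √(firstForm F' y).det = |(jacMatrix τ y).det| * √(firstForm F (τ y)).det := by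
  rw [h.firstForm_eq hy, sqrt_det_mul_mul_transpose]

lemma unitNormal_eq (hy : y ∈ V) :
    unitNormal F' y = (SignType.sign (jacMatrix τ y).det : ℝ) • unitNormal F (τ y) := by
  have hdet := abs_ne_zero.2 (h.det_jacMatrix_ne_zero hy)
  have hcross : cross (pd 0 F' y) (pd 1 F' y) (pd 2 F' y) =
      (jacMatrix τ y).det • cross (pd 0 F (τ y)) (pd 1 F (τ y)) (pd 2 F (τ y)) := by
    simp only [h.pd_eq hy]
    exact cross_sum_smul (jacMatrix τ y) fun a => pd a F (τ y)
  rw [unitNormal, hcross, norm_smul, unitNormal, smul_smul, smul_smul, mul_inv, Real.norm_eq_abs]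
  congr 1
  conv_lhs => enter [2]; rw [← sign_mul_abs (jacMatrix τ y).det]
  field_simp

lemma continuousOn_det_jacMatrix : ContinuousOn (fun z => (jacMatrix τ z).det) V := by
  have _hJ : ∀ i a, ContinuousOn (fun z => jacMatrix τ z i a) V := fun i a =>
    (EuclideanSpace.proj a).continuous.comp_continuousOn
      (continuousOn_pd h.right.isOpen h.contDiffOn i)
  simp only [Matrix.det_fin_three]
  fun_prop

lemma unitNormal_eventuallyEq (hy : y ∈ V) : unitNormal F' =ᶠ[𝓝 y]
    fun z => (SignType.sign (jacMatrix τ y).det : ℝ) • unitNormal F (τ z) := by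
  have hV := h.right.isOpen.mem_nhds hy
  have hsign := (continuousAt_sign_of_ne_zero (h.det_jacMatrix_ne_zero hy)).comp
    (f := fun z => (jacMatrix τ z).det) (h.continuousOn_det_jacMatrix.continuousAt hV)
  filter_upwards [hV, hsign.eventually_mem (isOpen_discrete {SignType.sign _} |>.mem_nhds rfl)]
    with z hz hzs
  rw [h.unitNormal_eq hz]
  exact congrArg (fun s : SignType => (s : ℝ) • unitNormal F (τ z)) hzs

lemma minkowskiDensity_eq (hy : y ∈ V) {η : E3 → ℝ} (hη : DifferentiableAt ℝ η (τ y)) :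
    minkowskiDensity (fun z => η (τ z)) F' (unitNormal F') y =
      |(jacMatrix τ y).det| * minkowskiDensity η F (unitNormal F) (τ y) := by
  rw [minkowskiDensity_congr .rfl (h.eventuallyEq hy) (h.unitNormal_eventuallyEq hy),
    minkowskiDensity_smul_normal (coe_sign_sq (h.det_jacMatrix_ne_zero hy)),
    minkowskiDensity_comp (h.differentiableAt hy) hη (h.left.differentiableAt (h.mapsTo hy))
      (h.left.differentiableAt_unitNormal (h.mapsTo hy)), ← mul_assoc, sign_mul_self]

lemma supportFunction_sq_eq (hy : y ∈ V) :
    supportFunction F' y ^ 2 = supportFunction F (τ y) ^ 2 := by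
  rw [supportFunction, h.unitNormal_eq hy, h.eqOn hy, inner_smul_right, mul_pow,
    coe_sign_sq (h.det_jacMatrix_ne_zero hy), one_mul]
  rfl

lemma secondForm_eq (hy : y ∈ V) :
    secondForm F' y = (SignType.sign (jacMatrix τ y).det : ℝ) •
      (jacMatrix τ y * secondForm F (τ y) * (jacMatrix τ y)ᵀ) := by
  have hyU := h.mapsTo hy
  have hν : DifferentiableAt ℝ (fun z => unitNormal F (τ z)) y :=
    (h.left.differentiableAt_unitNormal hyU).comp y (h.differentiableAt hy)
  have hpdν : ∀ i, pd i (unitNormal F') y = (SignType.sign (jacMatrix τ y).det : ℝ) •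
      ∑ a, jacMatrix τ y i a • pd a (unitNormal F) (τ y) := fun i => by
    rw [← pd_comp (h.differentiableAt hy) (h.left.differentiableAt_unitNormal hyU),
      pd_congr (h.unitNormal_eventuallyEq hy), pd_smul (by fun_prop) hν, pd_const,
      zero_smul, zero_add]
  ext i j
  rw [← neg_neg (secondForm F' y i j), ← h.right.inner_pd_pd_unitNormal hy, hpdν, h.pd_eq hy]
  simp only [inner_smul_right, inner_add_left, inner_add_right, inner_smul_left,
    h.left.inner_pd_pd_unitNormal hyU, Matrix.smul_apply, Matrix.mul_apply,
    Matrix.transpose_apply, Fin.sum_univ_three, RCLike.conj_to_real, smul_eq_mul]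
  ring

lemma abs_gaussKroneckerCoord_eq (hy : y ∈ V) :
    |gaussKroneckerCoord F' y| = |gaussKroneckerCoord F (τ y)| := by
  have hJ := h.det_jacMatrix_ne_zero hy
  have habs : |(SignType.sign (jacMatrix τ y).det : ℝ)| = 1 := by
    rw [← sq_eq_sq₀ (abs_nonneg _) zero_le_one, sq_abs, coe_sign_sq hJ, one_pow]
  rw [gaussKroneckerCoord_eq_div, gaussKroneckerCoord_eq_div, h.secondForm_eq hy,
    h.det_firstForm_eq hy, Matrix.det_smul, Matrix.det_mul, Matrix.det_mul, Matrix.det_transpose,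
    mul_right_comm, ← sq, mul_div_assoc, mul_div_mul_left _ _ (pow_ne_zero 2 hJ), abs_mul, abs_pow,
    habs, one_pow, one_mul]

end IsReparametrization

end Reparametrization

/-! ### The Riemannian metric and volume in charts -/

section Charts

variable {M : Type*} [TopologicalSpace M] [ChartedSpace E3 M]

/-- The local parametrization of the immersion `φ` given by the chart at `x`. -/
def chartMap (φ : M → E4) (x : M) (y : E3) : E4 := φ ((chartAt E3 x).symm y)

lemma chartMap_chart (φ : M → E4) (p : M) : chartMap φ p (chartAt E3 p p) = φ p := by
  rw [chartMap, (chartAt E3 p).left_inv (mem_chart_source E3 p)]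

/-- The change of coordinates from the chart at `x'` to the chart at `x`. -/
def transition (x x' : M) : OpenPartialHomeomorph E3 E3 := (chartAt E3 x').symm ≫ₕ chartAt E3 x

lemma mem_transition_source {x x' : M} {y : E3} : y ∈ (transition x x').source ↔
    y ∈ (chartAt E3 x').target ∧ (chartAt E3 x').symm y ∈ (chartAt E3 x).source := by
  rw [transition, OpenPartialHomeomorph.trans_source]
  rfl

lemma chart_mem_transition_source {x x' p : M} (hx : p ∈ (chartAt E3 x).source)
    (hx' : p ∈ (chartAt E3 x').source) : chartAt E3 x' p ∈ (transition x x').source :=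
  mem_transition_source.2
    ⟨(chartAt E3 x').map_source hx', by rwa [(chartAt E3 x').left_inv hx']⟩

lemma transition_chart {x x' p : M} (hx' : p ∈ (chartAt E3 x').source) :
    transition x x' (chartAt E3 x' p) = chartAt E3 x p :=
  congrArg (chartAt E3 x) ((chartAt E3 x').left_inv hx')

lemma transition_mem_target {x x' : M} {y : E3} (hy : y ∈ (transition x x').source) :
    transition x x' y ∈ (chartAt E3 x).target :=
  (chartAt E3 x).map_source (mem_transition_source.1 hy).2

lemma chart_symm_transition {x x' : M} {y : E3} (hy : y ∈ (transition x x').source) :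
    (chartAt E3 x).symm (transition x x' y) = (chartAt E3 x').symm y :=
  (chartAt E3 x).left_inv (mem_transition_source.1 hy).2

variable [IsManifold (𝓡 3) ∞ M]

lemma contDiffOn_transition (x x' : M) :
    ContDiffOn ℝ ∞ (transition x x') (transition x x').source := by
  rw [← contMDiffOn_iff_contDiffOn]
  exact (contMDiffOn_chart (I := 𝓡 3)).comp
    (contMDiffOn_chart_symm.mono fun _ hy => (mem_transition_source.1 hy).1)
    fun _ hy => (mem_transition_source.1 hy).2

lemma differentiableAt_transition {x x' : M} {y : E3} (hy : y ∈ (transition x x').source) :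
    DifferentiableAt ℝ (transition x x') y :=
  ((contDiffOn_transition x x').contDiffAt
    ((transition x x').open_source.mem_nhds hy)).differentiableAt (by simp)

lemma mdifferentiableAt_chart_symm (x : M) {y : E3} (hy : y ∈ (chartAt E3 x).target) :
    MDifferentiableAt (𝓡 3) (𝓡 3) (chartAt E3 x).symm y :=
  ((contMDiffOn_chart_symm (I := 𝓡 3) (n := ∞) (x := x)).contMDiffAt
    ((chartAt E3 x).open_target.mem_nhds hy)).mdifferentiableAt (by simp)

lemma mfderiv_chart_symm_injective (x : M) {y : E3} (hy : y ∈ (chartAt E3 x).target) :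
    Function.Injective (mfderiv (𝓡 3) (𝓡 3) (chartAt E3 x).symm y) := by
  have : IsManifold (𝓡 3) 1 M := IsManifold.of_le (n := ∞) (by simp)
  have hcomp := (mdifferentiable_chart (I := 𝓡 3) x).comp_symm_deriv hy
  exact Function.LeftInverse.injective
    (g := mfderiv (𝓡 3) (𝓡 3) (chartAt E3 x) ((chartAt E3 x).symm y))
    fun v => congrArg (fun L => L v) hcomp

lemma contDiffOn_comp_chart_symm {m : ℕ∞} {V : Type*} [NormedAddCommGroup V] [NormedSpace ℝ V]
    {f : M → V} (hf : ContMDiff (𝓡 3) 𝓘(ℝ, V) m f) (x : M) :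
    ContDiffOn ℝ m (fun y => f ((chartAt E3 x).symm y)) (chartAt E3 x).target := by
  rw [← contMDiffOn_iff_contDiffOn]
  have : IsManifold (𝓡 3) m M := IsManifold.of_le (n := ∞) (by exact_mod_cast le_top)
  exact hf.comp_contMDiffOn contMDiffOn_chart_symm

end Charts

section MetricCoeff

lemma map_sum_smul_sum_smul {V ι : Type*} [Fintype ι] [NormedAddCommGroup V] [NormedSpace ℝ V]
    (B : V →L[ℝ] V →L[ℝ] ℝ) (e : ι → V) (v w : ι → ℝ) :
    B (∑ i, v i • e i) (∑ j, w j • e j) =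
      v ⬝ᵥ (Matrix.of (fun i j => B (e i) (e j)) *ᵥ w) := by
  simp only [map_sum, map_smul, sum_apply, smul_apply, dotProduct, Matrix.mulVec,
    Matrix.of_apply, Finset.mul_sum, smul_eq_mul]
  rw [Finset.sum_comm]
  exact Finset.sum_congr rfl fun i _ => Finset.sum_congr rfl fun j _ => by ring

variable {M : Type*} [TopologicalSpace M] [ChartedSpace E3 M]

lemma mfderiv_chart_symm_eq_sum (x : M) (y v : E3) :
    (mfderiv (𝓡 3) (𝓡 3) (chartAt E3 x).symm y v : E3) = ∑ i, v i • (coordVec x i y : E3) := by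
  conv_lhs => rw [eq_sum_smul_stdVec v]
  exact (map_sum (mfderiv (𝓡 3) (𝓡 3) (chartAt E3 x).symm y : E3 →L[ℝ] E3) _ _).trans
    (Finset.sum_congr rfl fun i _ => map_smul _ _ _)

variable [IsManifold (𝓡 3) ∞ M] (g : SmoothMetric M)

lemma dotProduct_metricCoeff_mulVec (x : M) (y v w : E3) :
    v.ofLp ⬝ᵥ (metricCoeff g x y *ᵥ w.ofLp) = g.inner ((chartAt E3 x).symm y)
      (mfderiv (𝓡 3) (𝓡 3) (chartAt E3 x).symm y v)
      (mfderiv (𝓡 3) (𝓡 3) (chartAt E3 x).symm y w) := by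
  let B : E3 →L[ℝ] E3 →L[ℝ] ℝ := g.inner ((chartAt E3 x).symm y)
  calc v.ofLp ⬝ᵥ (metricCoeff g x y *ᵥ w.ofLp)
      = B (∑ i, v i • (coordVec x i y : E3)) (∑ j, w j • (coordVec x j y : E3)) :=
        (map_sum_smul_sum_smul B (fun i => coordVec x i y) v w).symm
    _ = _ := congrArg₂ (fun v w : E3 => B v w) (mfderiv_chart_symm_eq_sum x y v).symm
        (mfderiv_chart_symm_eq_sum x y w).symm

lemma posDef_metricCoeff (x : M) {y : E3} (hy : y ∈ (chartAt E3 x).target) :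
    (metricCoeff g x y).PosDef := by
  refine .of_dotProduct_mulVec_pos (Matrix.IsHermitian.ext fun i j => g.symm _ _ _) fun v hv => ?_
  rw [star_trivial, dotProduct_metricCoeff_mulVec g x y (WithLp.toLp 2 v) (WithLp.toLp 2 v)]
  refine g.pos _ _ fun hzero => hv ?_
  exact congrArg WithLp.ofLp (mfderiv_chart_symm_injective x hy (hzero.trans (map_zero _).symm))

lemma coordVec_eq_mfderiv_transition {x x' : M} {y : E3} (hy : y ∈ (transition x x').source)
    (i : Fin 3) : (coordVec x' i y : E3) =
      mfderiv (𝓡 3) (𝓡 3) (chartAt E3 x).symm (transition x x' y)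
        (pd (V := E3) i (transition x x') y) := by
  have hsymm : (chartAt E3 x').symm =ᶠ[𝓝 y] (chartAt E3 x).symm ∘ transition x x' := by
    filter_upwards [(transition x x').open_source.mem_nhds hy] with z hz
      using (chart_symm_transition hz).symm
  have hcomp := mfderiv_comp y (mdifferentiableAt_chart_symm x (transition_mem_target hy))
    (differentiableAt_transition hy).mdifferentiableAt
  rw [mfderiv_eq_fderiv] at hcomp
  rw [coordVec, hsymm.mfderiv_eq]
  exact congrArg (fun L : E3 →L[ℝ] E3 => L (stdVec i)) hcomp

lemma metricCoeff_transition {x x' : M} {y : E3} (hy : y ∈ (transition x x').source) :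
    metricCoeff g x' y = jacMatrix (transition x x') y * metricCoeff g x (transition x x' y) *
      (jacMatrix (transition x x') y)ᵀ := by
  ext i j
  let B (p : M) : E3 →L[ℝ] E3 →L[ℝ] ℝ := g.inner p
  calc metricCoeff g x' y i j
      = B ((chartAt E3 x).symm (transition x x' y)) (coordVec x' i y) (coordVec x' j y) := by
        rw [chart_symm_transition hy]
        rfl
    _ = (pd i (transition x x') y).ofLp ⬝ᵥ
          (metricCoeff g x (transition x x' y) *ᵥ (pd j (transition x x') y).ofLp) := by
        rw [coordVec_eq_mfderiv_transition hy, coordVec_eq_mfderiv_transition hy,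
          dotProduct_metricCoeff_mulVec]
        rfl
    _ = _ := by
        rw [Matrix.dotProduct_mulVec]
        rfl

lemma contMDiffAt_coordVec (x : M) {y : E3} (hy : y ∈ (chartAt E3 x).target) (i : Fin 3) :
    ContMDiffAt (𝓡 3) ((𝓡 3).prod 𝓘(ℝ, E3)) 2 (fun z => Bundle.TotalSpace.mk' E3
      (E := fun p : M => TangentSpace (𝓡 3) p) ((chartAt E3 x).symm z) (coordVec x i z)) y := by
  have : IsManifold (𝓡 3) 1 M := IsManifold.of_le (n := ∞) (by simp)
  have hsymm : ContMDiffAt (𝓡 3) (𝓡 3) ∞ (chartAt E3 x).symm y :=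
    contMDiffOn_chart_symm.contMDiffAt ((chartAt E3 x).open_target.mem_nhds hy)
  have hderiv := (hsymm.mfderiv_const (m := 2) (by norm_cast)).clm_apply
    (contMDiffAt_const (c := (stdVec i : E3)) (I := 𝓡 3) (x := y) (n := 2))
  refine Bundle.contMDiffAt_totalSpace.2
    ⟨hsymm.of_le (by norm_cast), hderiv.congr_of_eventuallyEq ?_⟩
  filter_upwards [hsymm.continuousAt.eventually_mem
    ((chartAt E3 _).open_source.mem_nhds (mem_chart_source _ _))] with z hz
  have hcoord := inTangentCoordinates_eq (I := 𝓡 3) (I' := 𝓡 3) (M := E3) (M' := M) id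
    (chartAt E3 x).symm (fun z => (mfderiv (𝓡 3) (𝓡 3) (chartAt E3 x).symm z : E3 →L[ℝ] E3))
    (x₀ := y) (x := z) (mem_univ z) hz
  rw [tangentBundleCore_coordChange_model_space] at hcoord
  exact (congrArg (fun L : E3 →L[ℝ] E3 => L (stdVec i)) hcoord).symm

lemma contDiffOn_metricCoeff (x : M) (i j : Fin 3) :
    ContDiffOn ℝ 2 (fun y => metricCoeff g x y i j) (chartAt E3 x).target := by
  rw [← contMDiffOn_iff_contDiffOn]
  intro y hy
  have hsymm : ContMDiffAt (𝓡 3) (𝓡 3) ∞ (chartAt E3 x).symm y :=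
    contMDiffOn_chart_symm.contMDiffAt ((chartAt E3 x).open_target.mem_nhds hy)
  have hg : ContMDiffAt (𝓡 3) ((𝓡 3).prod 𝓘(ℝ, E3 →L[ℝ] E3 →L[ℝ] ℝ)) 2
      (fun y => Bundle.TotalSpace.mk' (E3 →L[ℝ] E3 →L[ℝ] ℝ)
        (E := fun p : M => TangentSpace (𝓡 3) p →L[ℝ] TangentSpace (𝓡 3) p →L[ℝ] ℝ)
        ((chartAt E3 x).symm y) (g.inner ((chartAt E3 x).symm y))) y :=
    (g.contMDiff.of_le (by norm_cast)).contMDiffAt.comp y (hsymm.of_le (by norm_cast))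
  have hcoeff := ContMDiffAt.clm_bundle_apply₂ (F₃ := ℝ) (E₃ := Bundle.Trivial M ℝ) hg
    (contMDiffAt_coordVec x hy i) (contMDiffAt_coordVec x hy j)
  exact (Bundle.contMDiffAt_totalSpace.1 hcoeff).2.contMDiffWithinAt

lemma continuousOn_sqrt_det_metricCoeff (x : M) :
    ContinuousOn (fun y => √(metricCoeff g x y).det) (chartAt E3 x).target := by
  have _hc : ∀ i j, ContinuousOn (fun y => metricCoeff g x y i j) (chartAt E3 x).target :=
    fun i j => (contDiffOn_metricCoeff g x i j).continuousOn
  simp only [Matrix.det_fin_three]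
  exact ContinuousOn.sqrt (by fun_prop)

end MetricCoeff

section Volume

lemma iSup_measure_apply_of_subset {X ι : Type*} [MeasurableSpace X] {m : ι → Measure X}
    {s : ι → Set X} (hs : ∀ i, MeasurableSet (s i)) (hm : ∀ i, m i (s i)ᶜ = 0)
    (hagree : ∀ i j E, MeasurableSet E → E ⊆ s i ∩ s j → m i E = m j E) (i : ι) {E : Set X}
    (hE : E ⊆ s i) : (⨆ j, m j) E = m i E := by
  refine le_antisymm ?_ (le_iSup m i E)
  have hle : (⨆ j, m j) ≤ m i + (⊤ : Measure X).restrict (s i)ᶜ := by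
    refine iSup_le fun j => Measure.le_iff.2 fun A hA => ?_
    have hdiff : m j ((A ∩ s i) \ s j) = 0 := measure_mono_null (fun _ hx => hx.2) (hm j)
    rw [Measure.add_apply, Measure.restrict_apply hA, ← measure_inter_add_sdiff A (hs i),
      ← measure_inter_add_sdiff (A ∩ s i) (hs j), hdiff, add_zero,
      hagree j i _ ((hA.inter (hs i)).inter (hs j)) fun x hx => ⟨hx.2, hx.1.2⟩]
    exact add_le_add (measure_mono fun x hx => hx.1.1) ((le_top : m j ≤ ⊤) _)
  have htop : (⊤ : Measure X).restrict (s i)ᶜ E = 0 := by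
    rw [Measure.restrict_apply' (hs i).compl,
      (disjoint_compl_right_iff_subset.2 hE).inter_eq, measure_empty]
  simpa only [Measure.add_apply, htop, add_zero] using hle E

lemma det_fderiv_eq_det_jacMatrix (τ : E3 → E3) (y : E3) :
    (fderiv ℝ τ y).det = (jacMatrix τ y).det := by
  let b := (EuclideanSpace.basisFun (Fin 3) ℝ).toBasis
  rw [ContinuousLinearMap.det, ← LinearMap.det_toMatrix b, ← Matrix.det_transpose]
  congr 1

variable {M : Type*} [TopologicalSpace M] [ChartedSpace E3 M]

/-- The coordinates, in the chart at `x`, of the points of `E` in the domain of that chart. -/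
def chartSet (x : M) (E : Set M) : Set E3 := (chartAt E3 x).target ∩ (chartAt E3 x).symm ⁻¹' E

lemma isOpen_chartSet (x : M) {E : Set M} (hE : IsOpen E) : IsOpen (chartSet x E) :=
  (chartAt E3 x).isOpen_inter_preimage_symm hE

lemma chartSet_eq_image_transition {x x' : M} {E : Set M}
    (hE : E ⊆ (chartAt E3 x).source ∩ (chartAt E3 x').source) :
    chartSet x E = transition x x' '' chartSet x' E := by
  ext z
  constructor
  · rintro ⟨hz, hzE⟩
    have hz' := (hE hzE).2
    refine ⟨chartAt E3 x' ((chartAt E3 x).symm z), ⟨(chartAt E3 x').map_source hz', ?_⟩, ?_⟩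
    · rwa [mem_preimage, (chartAt E3 x').left_inv hz']
    · rw [transition_chart hz', (chartAt E3 x).right_inv hz]
  · rintro ⟨y, ⟨hy, hyE⟩, rfl⟩
    have hyτ := mem_transition_source.2 ⟨hy, (hE hyE).1⟩
    exact ⟨transition_mem_target hyτ, by rwa [mem_preimage, chart_symm_transition hyτ]⟩

variable [MeasurableSpace M] [BorelSpace M]

lemma measurableSet_chartSet (x : M) {E : Set M} (hE : MeasurableSet E) :
    MeasurableSet (chartSet x E) := by
  have himage : chartSet x E =
      Subtype.val '' ((chartAt E3 x).target.domRestrict (chartAt E3 x).symm ⁻¹' E) := by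
    ext y; simp [chartSet, and_comm]
  rw [himage]
  exact (chartAt E3 x).open_target.measurableSet.subtype_image
    ((chartAt E3 x).continuousOn_symm.domRestrict.measurable hE)

lemma aemeasurable_chart_symm (x : M) (f : E3 → ENNReal) : AEMeasurable (chartAt E3 x).symm
    ((volume.restrict (chartAt E3 x).target).withDensity f) :=
  ((chartAt E3 x).continuousOn_symm.aemeasurable
    (chartAt E3 x).open_target.measurableSet).mono_ac (withDensity_absolutelyContinuous _ _)

variable [IsManifold (𝓡 3) ∞ M] (g : SmoothMetric M)

lemma chartVolume_apply (x : M) {E : Set M} (hE : MeasurableSet E) :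
    chartVolume g x E = ∫⁻ y in chartSet x E, ENNReal.ofReal √(metricCoeff g x y).det := by
  rw [chartVolume, Measure.map_apply_of_aemeasurable (aemeasurable_chart_symm x _) hE,
    withDensity_apply', Measure.restrict_restrict' (chartAt E3 x).open_target.measurableSet,
    inter_comm]
  rfl

lemma chartVolume_compl_source (x : M) : chartVolume g x (chartAt E3 x).sourceᶜ = 0 := by
  have hempty : chartSet x (chartAt E3 x).sourceᶜ = ∅ :=
    eq_empty_of_forall_notMem fun y hy => hy.2 ((chartAt E3 x).map_target hy.1)
  rw [chartVolume_apply g x (chartAt E3 x).open_source.measurableSet.compl, hempty,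
    setLIntegral_empty]

lemma chartVolume_eq_of_subset (x x' : M) {E : Set M} (hE : MeasurableSet E)
    (hEs : E ⊆ (chartAt E3 x).source ∩ (chartAt E3 x').source) :
    chartVolume g x E = chartVolume g x' E := by
  have hsub : chartSet x' E ⊆ (transition x x').source := fun y hy =>
    mem_transition_source.2 ⟨hy.1, (hEs hy.2).1⟩
  rw [chartVolume_apply g x hE, chartVolume_apply g x' hE, chartSet_eq_image_transition hEs,
    lintegral_image_eq_lintegral_abs_det_fderiv_mul volume (measurableSet_chartSet x' hE)
      (fun y hy => (differentiableAt_transition (hsub hy)).hasFDerivAt.hasFDerivWithinAt)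
      ((transition x x').injOn.mono hsub)]
  refine setLIntegral_congr_fun (measurableSet_chartSet x' hE) fun y hy => ?_
  rw [det_fderiv_eq_det_jacMatrix, ← ENNReal.ofReal_mul (abs_nonneg _),
    metricCoeff_transition g (hsub hy), sqrt_det_mul_mul_transpose]

lemma vol_apply_of_subset (x : M) {E : Set M} (hE : E ⊆ (chartAt E3 x).source) :
    vol g E = chartVolume g x E :=
  iSup_measure_apply_of_subset (s := fun x => (chartAt E3 x).source)
    (fun x => (chartAt E3 x).open_source.measurableSet) (chartVolume_compl_source g)
    (fun x x' _ => chartVolume_eq_of_subset g x x') x hE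

lemma vol_restrict_source (x : M) :
    (vol g).restrict (chartAt E3 x).source = chartVolume g x := by
  ext E hE
  have hdiff : chartVolume g x (E \ (chartAt E3 x).source) = 0 :=
    measure_mono_null (fun _ hx => hx.2) (chartVolume_compl_source g x)
  rw [Measure.restrict_apply hE, vol_apply_of_subset g x inter_subset_right,
    ← measure_inter_add_sdiff E (chartAt E3 x).open_source.measurableSet, hdiff, add_zero]

lemma volume_chartSet_eq_zero (x : M) {E : Set M} (hE : MeasurableSet E)
    (hvol : chartVolume g x E = 0) : volume (chartSet x E) = 0 := by
  have ht := (chartAt E3 x).open_target.measurableSet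
  rw [chartVolume, Measure.map_apply_of_aemeasurable (aemeasurable_chart_symm x _) hE] at hvol
  have hpos : ∀ᵐ y ∂volume.restrict (chartAt E3 x).target,
      ENNReal.ofReal √(metricCoeff g x y).det ≠ 0 :=
    (ae_restrict_mem ht).mono fun y hy =>
      (ENNReal.ofReal_pos.2 (Real.sqrt_pos.2 (posDef_metricCoeff g x hy).det_pos)).ne'
  have hzero := withDensity_absolutelyContinuous' ((continuousOn_sqrt_det_metricCoeff g
    x).aemeasurable ht).ennreal_ofReal hpos hvol
  rwa [Measure.restrict_apply' ht, inter_comm] at hzero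

lemma isOpenPosMeasure_vol : (vol g).IsOpenPosMeasure where
  open_pos U hU hne hvol := by
    obtain ⟨p, hp⟩ := hne
    have hUp := hU.inter (chartAt E3 p).open_source
    have hmem : chartAt E3 p p ∈ chartSet p (U ∩ (chartAt E3 p).source) :=
      ⟨mem_chart_target E3 p, by
        rw [mem_preimage, (chartAt E3 p).left_inv (mem_chart_source E3 p)]
        exact ⟨hp, mem_chart_source E3 p⟩⟩
    refine (isOpen_chartSet p hUp).measure_ne_zero volume ⟨_, hmem⟩
      (volume_chartSet_eq_zero g p hUp.measurableSet ?_)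
    rw [← vol_apply_of_subset g p inter_subset_right]
    exact measure_mono_null inter_subset_left hvol

lemma isFiniteMeasure_vol [CompactSpace M] : IsFiniteMeasure (vol g) := by
  refine ⟨isCompact_univ.measure_lt_top_of_nhdsWithin fun p _ => ?_⟩
  rw [nhdsWithin_univ]
  obtain ⟨K, hK, hpK, hKt⟩ := exists_compact_subset (chartAt E3 p).open_target
    (mem_chart_target E3 p)
  have hO : IsOpen ((chartAt E3 p).source ∩ chartAt E3 p ⁻¹' interior K) :=
    (chartAt E3 p).isOpen_inter_preimage isOpen_interior
  refine ⟨_, hO.mem_nhds ⟨mem_chart_source E3 p, hpK⟩, ?_⟩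
  have hsub : chartSet p ((chartAt E3 p).source ∩ chartAt E3 p ⁻¹' interior K) ⊆ K := by
    rintro y ⟨hy, -, hyK⟩
    rw [mem_preimage, (chartAt E3 p).right_inv hy] at hyK
    exact interior_subset hyK
  have hinteg : IntegrableOn (fun y => √(metricCoeff g p y).det) K :=
    ((continuousOn_sqrt_det_metricCoeff g p).mono hKt).integrableOn_compact hK
  rw [vol_apply_of_subset g p inter_subset_left, chartVolume_apply g p hO.measurableSet]
  exact (lintegral_mono_set hsub).trans_lt hinteg.lintegral_lt_top

lemma integral_vol_eq (x : M) {f : M → ℝ} (hf : Function.support f ⊆ (chartAt E3 x).source)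
    (hfm : AEStronglyMeasurable f (vol g)) :
    ∫ p, f p ∂(vol g) = ∫ y in (chartAt E3 x).target,
      √(metricCoeff g x y).det * f ((chartAt E3 x).symm y) := by
  have ht := (chartAt E3 x).open_target.measurableSet
  have hdens : AEMeasurable (fun y => Real.toNNReal √(metricCoeff g x y).det)
      (volume.restrict (chartAt E3 x).target) :=
    ((continuousOn_sqrt_det_metricCoeff g x).aemeasurable ht).real_toNNReal
  have hfx : AEStronglyMeasurable f (chartVolume g x) := by
    rw [← vol_restrict_source g x]
    exact hfm.restrict
  rw [← setIntegral_eq_integral_of_forall_compl_eq_zero (s := (chartAt E3 x).source)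
    fun p hp => by_contra fun hne => hp (hf hne), vol_restrict_source g x]
  unfold chartVolume at hfx ⊢
  rw [integral_map (aemeasurable_chart_symm x _) hfx]
  simp only [ENNReal.ofReal, integral_withDensity_eq_integral_smul₀ hdens, NNReal.smul_def,
    Real.coe_toNNReal _ (Real.sqrt_nonneg _), smul_eq_mul]

end Volume

/-! ### Integration over the hypersurface -/

section ParametrizedImmersion

variable {F : E3 → E4} {U : Set E3} {y : E3}

lemma dotProduct_firstForm_mulVec (F : E3 → E4) (y : E3) (v w : Fin 3 → ℝ) :
    v ⬝ᵥ (firstForm F y *ᵥ w) = inner ℝ (∑ i, v i • pd i F y) (∑ i, w i • pd i F y) :=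
  (map_sum_smul_sum_smul (innerSL ℝ) (fun i => pd i F y) v w).symm

lemma sum_smul_pd {V : Type*} [NormedAddCommGroup V] [NormedSpace ℝ V] (f : E3 → V) (y v : E3) :
    ∑ i, v i • pd i f y = fderiv ℝ f y v := by
  conv_rhs => rw [eq_sum_smul_stdVec v]
  simp only [pd, map_sum, map_smul]

namespace IsImmersionOn

lemma mono {V : Set E3} (hF : IsImmersionOn F U) (hV : IsOpen V) (hVU : V ⊆ U) :
    IsImmersionOn F V where
  isOpen := hV
  contDiffOn := hF.contDiffOn.mono hVU
  det_ne_zero y hy := hF.det_ne_zero y (hVU hy)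

variable (hF : IsImmersionOn F U)
include hF

lemma continuousOn_det_firstForm : ContinuousOn (fun y => (firstForm F y).det) U := by
  have _hG : ∀ i j, ContinuousOn (fun y => firstForm F y i j) U := fun i j =>
    (hF.contDiffOn_pd i).continuousOn.inner (hF.contDiffOn_pd j).continuousOn
  simp only [Matrix.det_fin_three]
  fun_prop

lemma continuousOn_det_secondForm : ContinuousOn (fun y => (secondForm F y).det) U := by
  have _hh : ∀ i j, ContinuousOn (fun y => secondForm F y i j) U := fun i j =>
    (Hypersurface.contDiffOn_pd (m := 0) hF.isOpen (hF.contDiffOn_pd j) (by norm_num)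
      i).continuousOn.inner hF.contDiffOn_unitNormal.continuousOn
  simp only [Matrix.det_fin_three]
  fun_prop

lemma continuousOn_gaussKroneckerCoord : ContinuousOn (gaussKroneckerCoord F) U := by
  rw [funext (gaussKroneckerCoord_eq_div F)]
  exact hF.continuousOn_det_secondForm.div hF.continuousOn_det_firstForm hF.det_ne_zero

lemma norm_sq_position (hy : y ∈ U) : ‖F y‖ ^ 2 =
    tangentialCoord F y ⬝ᵥ (firstForm F y *ᵥ tangentialCoord F y) + supportFunction F y ^ 2 := by
  have hperp : inner ℝ (∑ k, tangentialCoord F y k • pd k F y)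
      (supportFunction F y • unitNormal F y) = (0 : ℝ) := by
    simp only [sum_inner, inner_smul_left, inner_smul_right, inner_pd_unitNormal, mul_zero,
      Finset.sum_const_zero]
  rw [dotProduct_firstForm_mulVec, real_inner_self_eq_norm_sq]
  conv_lhs => rw [hF.position_eq_frameVec hy, frameVec]
  rw [norm_add_sq_real, hperp, norm_smul, hF.norm_unitNormal hy, mul_one, Real.norm_eq_abs,
    sq_abs, mul_zero, add_zero]

end IsImmersionOn

end ParametrizedImmersion

section Global

variable {M : Type*} [TopologicalSpace M] [ChartedSpace E3 M]

/-- The support function of `φ` at `p`, for the unit normal attached to the orientation of the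
chart at `p`. -/
def supportAt (φ : M → E4) (p : M) : ℝ := supportFunction (chartMap φ p) (chartAt E3 p p)

/-- The density, with respect to the Riemannian volume, of the exterior derivative of the 2-form
`χ (det (X, ν, dX, dX) + p det (X, ν, dX, dν) + p² det (X, ν, dν, dν))` on `M`, where `X = φ` is
the position vector and `p = ⟨X, ν⟩`. Reversing `ν` reverses both the form and the orientation,
so that no orientability is needed. -/
def minkowskiDeriv (φ : M → E4) (χ : M → ℝ) (p : M) : ℝ :=
  minkowskiDensity (fun y => χ ((chartAt E3 p).symm y)) (chartMap φ p)
    (unitNormal (chartMap φ p)) (chartAt E3 p p) /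
    √(firstForm (chartMap φ p) (chartAt E3 p p)).det

lemma continuous_of_eq_comp_chart {Y : Type*} [TopologicalSpace Y] {u : M → Y} {v : M → E3 → Y}
    (hu : ∀ x, ∀ p ∈ (chartAt E3 x).source, u p = v x (chartAt E3 x p))
    (hv : ∀ x, ContinuousOn (v x) (chartAt E3 x).target) : Continuous u := by
  refine continuous_iff_continuousAt.2 fun x => ?_
  have hsource := (chartAt E3 x).open_source.mem_nhds (mem_chart_source E3 x)
  refine (((hv x).comp (chartAt E3 x).continuousOn (chartAt E3 x).mapsTo).continuousAt
    hsource).congr ?_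
  filter_upwards [hsource] with p hp using (hu x p hp).symm

lemma minkowskiDeriv_eq_zero_of_notMem_tsupport {φ : M → E4} {χ : M → ℝ} {p : M}
    (hp : p ∉ tsupport χ) : minkowskiDeriv φ χ p = 0 := by
  have hsymm := (chartAt E3 p).tendsto_symm (mem_chart_source E3 p)
  rw [minkowskiDeriv, minkowskiDensity_eq_zero
    (hsymm.eventually (notMem_tsupport_iff_eventuallyEq.1 hp)), zero_div]

variable [IsManifold (𝓡 3) ∞ M] {g : SmoothMetric M} {φ : M → E4} {χ : M → ℝ}

lemma differentiableAt_comp_chart_symm (hχ : ContMDiff (𝓡 3) 𝓘(ℝ, ℝ) 1 χ) (x : M) {y : E3}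
    (hy : y ∈ (chartAt E3 x).target) :
    DifferentiableAt ℝ (fun y => χ ((chartAt E3 x).symm y)) y :=
  ((contDiffOn_comp_chart_symm (m := 1) hχ x).contDiffAt
    ((chartAt E3 x).open_target.mem_nhds hy)).differentiableAt (by norm_num)

lemma exists_compactSupport_extension_comp_chart_symm [CompactSpace M]
    (hχ : ContMDiff (𝓡 3) 𝓘(ℝ, ℝ) 1 χ) (x : M) (hx : tsupport χ ⊆ (chartAt E3 x).source) :
    ∃ η : E3 → ℝ, EqOn η (fun y => χ ((chartAt E3 x).symm y)) (chartAt E3 x).target ∧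
      ContDiffOn ℝ 1 η (chartAt E3 x).target ∧ HasCompactSupport η ∧
      tsupport η ⊆ (chartAt E3 x).target := by
  classical
  let η := (chartAt E3 x).target.indicator fun y => χ ((chartAt E3 x).symm y)
  have hη : EqOn η (fun y => χ ((chartAt E3 x).symm y)) (chartAt E3 x).target := fun y hy =>
    indicator_of_mem hy _
  have hK : IsCompact (chartAt E3 x '' tsupport χ) :=
    (isClosed_tsupport χ).isCompact.image_of_continuousOn ((chartAt E3 x).continuousOn.mono hx)
  have hsub : tsupport η ⊆ chartAt E3 x '' tsupport χ := by
    refine closure_minimal (fun y hy => ?_) hK.isClosed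
    have hyt : y ∈ (chartAt E3 x).target := by_contra fun h0 => hy (indicator_of_notMem h0 _)
    refine ⟨(chartAt E3 x).symm y, subset_tsupport χ ?_, (chartAt E3 x).right_inv hyt⟩
    exact fun h0 => hy ((hη hyt).trans h0)
  refine ⟨η, hη, (contDiffOn_comp_chart_symm (m := 1) hχ x).congr hη,
    hK.of_isClosed_subset (isClosed_tsupport η) hsub, hsub.trans ?_⟩
  rintro - ⟨p, hp, rfl⟩
  exact (chartAt E3 x).map_source (hx hp)

namespace IsIsometricImmersion

variable (h : IsIsometricImmersion g φ)
include h

lemma contDiffOn_chartMap (x : M) : ContDiffOn ℝ 2 (chartMap φ x) (chartAt E3 x).target :=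
  contDiffOn_comp_chart_symm (m := 2) h.contMDiff x

lemma fderiv_chartMap (x : M) {y : E3} (hy : y ∈ (chartAt E3 x).target) (v : E3) :
    fderiv ℝ (chartMap φ x) y v = mfderiv (𝓡 3) (𝓡 4) φ ((chartAt E3 x).symm y)
      (mfderiv (𝓡 3) (𝓡 3) (chartAt E3 x).symm y v) := by
  have hcomp := mfderiv_comp y (h.contMDiff.contMDiffAt.mdifferentiableAt (by norm_num))
    (mdifferentiableAt_chart_symm x hy)
  rw [mfderiv_eq_fderiv] at hcomp
  exact congrArg (fun L : E3 →L[ℝ] E4 => L v) hcomp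

lemma metricCoeff_eq_firstForm (x : M) {y : E3} (hy : y ∈ (chartAt E3 x).target) :
    metricCoeff g x y = firstForm (chartMap φ x) y := by
  ext i j
  rw [firstForm, Matrix.of_apply, pd, pd, h.fderiv_chartMap x hy, h.fderiv_chartMap x hy]
  exact (h.isometric _ _ _).symm

lemma isImmersionOn_chartMap (x : M) : IsImmersionOn (chartMap φ x) (chartAt E3 x).target where
  isOpen := (chartAt E3 x).open_target
  contDiffOn := h.contDiffOn_chartMap x
  det_ne_zero y hy := by
    rw [← h.metricCoeff_eq_firstForm x hy]
    exact (posDef_metricCoeff g x hy).det_pos.ne'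

lemma isReparametrization_transition (x x' : M) :
    IsReparametrization (chartMap φ x) (chartAt E3 x).target (chartMap φ x')
      (transition x x').source (transition x x') where
  left := h.isImmersionOn_chartMap x
  right := (h.isImmersionOn_chartMap x').mono (transition x x').open_source
    fun _ hy => (mem_transition_source.1 hy).1
  contDiffOn := (contDiffOn_transition x x').of_le (by simp)
  mapsTo _ := transition_mem_target
  eqOn _ hy := congrArg φ (chart_symm_transition hy).symm

lemma abs_gaussKronecker_eq (x p : M) (hp : p ∈ (chartAt E3 x).source) :
    |gaussKronecker φ p| = |gaussKroneckerCoord (chartMap φ x) (chartAt E3 x p)| := by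
  have hp' := mem_chart_source E3 p
  rw [← transition_chart (x := x) hp']
  exact (h.isReparametrization_transition x p).abs_gaussKroneckerCoord_eq
    (chart_mem_transition_source hp hp')

lemma supportAt_sq_eq (x p : M) (hp : p ∈ (chartAt E3 x).source) :
    supportAt φ p ^ 2 = supportFunction (chartMap φ x) (chartAt E3 x p) ^ 2 := by
  have hp' := mem_chart_source E3 p
  rw [← transition_chart (x := x) hp']
  exact (h.isReparametrization_transition x p).supportFunction_sq_eq
    (chart_mem_transition_source hp hp')

lemma minkowskiDeriv_eq (hχ : ContMDiff (𝓡 3) 𝓘(ℝ, ℝ) 1 χ) (x p : M)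
    (hp : p ∈ (chartAt E3 x).source) : minkowskiDeriv φ χ p =
      minkowskiDensity (fun y => χ ((chartAt E3 x).symm y)) (chartMap φ x)
        (unitNormal (chartMap φ x)) (chartAt E3 x p) /
        √(firstForm (chartMap φ x) (chartAt E3 x p)).det := by
  have hr := h.isReparametrization_transition x p
  have hp' := mem_chart_source E3 p
  have hy := chart_mem_transition_source hp hp'
  have hχτ : (fun y => χ ((chartAt E3 p).symm y)) =ᶠ[𝓝 (chartAt E3 p p)]
      fun y => χ ((chartAt E3 x).symm (transition x p y)) := by
    filter_upwards [(transition x p).open_source.mem_nhds hy] with y hy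
    rw [chart_symm_transition hy]
  rw [minkowskiDeriv, minkowskiDensity_congr hχτ .rfl .rfl,
    hr.minkowskiDensity_eq hy (differentiableAt_comp_chart_symm hχ x (transition_mem_target hy)),
    hr.sqrt_det_firstForm_eq hy, transition_chart hp',
    mul_div_mul_left _ _ (abs_ne_zero.2 (hr.det_jacMatrix_ne_zero hy))]

lemma continuous_abs_gaussKronecker : Continuous fun p => |gaussKronecker φ p| :=
  continuous_of_eq_comp_chart (v := fun x y => |gaussKroneckerCoord (chartMap φ x) y|)
    h.abs_gaussKronecker_eq
    fun x => (h.isImmersionOn_chartMap x).continuousOn_gaussKroneckerCoord.abs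

lemma continuous_supportAt_sq : Continuous fun p => supportAt φ p ^ 2 :=
  continuous_of_eq_comp_chart (v := fun x y => supportFunction (chartMap φ x) y ^ 2)
    h.supportAt_sq_eq
    fun x => (h.isImmersionOn_chartMap x).contDiffOn_supportFunction.continuousOn.pow 2

lemma continuous_minkowskiDeriv (hχ : ContMDiff (𝓡 3) 𝓘(ℝ, ℝ) 1 χ) :
    Continuous (minkowskiDeriv φ χ) :=
  continuous_of_eq_comp_chart (v := fun x y => minkowskiDensity
    (fun y => χ ((chartAt E3 x).symm y)) (chartMap φ x) (unitNormal (chartMap φ x)) y /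
      √(firstForm (chartMap φ x) y).det) (h.minkowskiDeriv_eq hχ) fun x =>
    have hF := h.isImmersionOn_chartMap x
    (continuousOn_minkowskiDensity hF.isOpen (contDiffOn_comp_chart_symm (m := 1) hχ x)
      (hF.contDiffOn.of_le (by norm_num)) hF.contDiffOn_unitNormal).div
      hF.continuousOn_det_firstForm.sqrt fun _ hy => (hF.sqrt_det_firstForm_pos hy).ne'

lemma minkowskiDeriv_sum {ι : Type*} (s : Finset ι) {χ : ι → M → ℝ}
    (hχ : ∀ i ∈ s, ContMDiff (𝓡 3) 𝓘(ℝ, ℝ) 1 (χ i)) (p : M) :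
    minkowskiDeriv φ (fun q => ∑ i ∈ s, χ i q) p = ∑ i ∈ s, minkowskiDeriv φ (χ i) p := by
  have hF := h.isImmersionOn_chartMap p
  have hy := mem_chart_target E3 p
  simp only [minkowskiDeriv]
  rw [minkowskiDensity_sum (fun i hi => differentiableAt_comp_chart_symm (hχ i hi) p hy)
    (hF.differentiableAt hy) (hF.differentiableAt_unitNormal hy), Finset.sum_div]

variable [MeasurableSpace M] [BorelSpace M]

lemma integral_minkowskiDeriv_of_tsupport_subset [CompactSpace M]
    (hχ : ContMDiff (𝓡 3) 𝓘(ℝ, ℝ) 1 χ) (x : M) (hx : tsupport χ ⊆ (chartAt E3 x).source) :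
    ∫ p, minkowskiDeriv φ χ p ∂(vol g) = 0 := by
  have hF := h.isImmersionOn_chartMap x
  have hsupp : Function.support (minkowskiDeriv φ χ) ⊆ (chartAt E3 x).source := fun p hp =>
    hx (by_contra fun h0 => hp (minkowskiDeriv_eq_zero_of_notMem_tsupport h0))
  obtain ⟨η, hη, hηd, hc, hηt⟩ := exists_compactSupport_extension_comp_chart_symm hχ x hx
  rw [integral_vol_eq g x hsupp (h.continuous_minkowskiDeriv hχ).aestronglyMeasurable,
    ← integral_minkowskiDensity_eq_zero hF.isOpen hηd hc hηt
      (hF.contDiffOn.of_le (by norm_num)) hF.contDiffOn_unitNormal,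
    ← setIntegral_eq_integral_of_forall_compl_eq_zero (s := (chartAt E3 x).target) fun y hy =>
      minkowskiDensity_eq_zero (notMem_tsupport_iff_eventuallyEq.1 fun h0 => hy (hηt h0))]
  refine setIntegral_congr_fun hF.isOpen.measurableSet fun y hy => ?_
  rw [minkowskiDensity_congr (hη.eventuallyEq_of_mem (hF.isOpen.mem_nhds hy)) .rfl .rfl]
  simp only [h.metricCoeff_eq_firstForm x hy]
  rw [h.minkowskiDeriv_eq hχ x _ ((chartAt E3 x).map_target hy), (chartAt E3 x).right_inv hy,
    mul_div_cancel₀ _ (hF.sqrt_det_firstForm_pos hy).ne']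

lemma integral_minkowskiDeriv_one [CompactSpace M] [T2Space M] :
    ∫ p, minkowskiDeriv φ (fun _ => 1) p ∂(vol g) = 0 := by
  have := isFiniteMeasure_vol g
  obtain ⟨f, hf⟩ := SmoothPartitionOfUnity.exists_isSubordinate_chartAt_source (𝓡 3) M
  have hfin : {i | (Function.support (f i)).Nonempty}.Finite :=
    f.locallyFinite.finite_nonempty_of_compact
  have hf1 : ∀ i, ContMDiff (𝓡 3) 𝓘(ℝ, ℝ) 1 (f i) := fun i => (f i).contMDiff.of_le (by simp)
  have hsum : (fun _ : M => (1 : ℝ)) = fun q => ∑ i ∈ hfin.toFinset, f i q := by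
    ext q
    rw [← f.sum_eq_one (mem_univ q)]
    refine finsum_eq_sum_of_support_subset _ fun i hi => ?_
    rw [Finite.coe_toFinset]
    exact ⟨q, hi⟩
  have hinteg : ∀ i, Integrable (minkowskiDeriv φ (f i)) (vol g) := fun i =>
    (h.continuous_minkowskiDeriv (hf1 i)).integrable_of_hasCompactSupport
      (HasCompactSupport.of_compactSpace _)
  simp only [hsum, h.minkowskiDeriv_sum _ fun i _ => hf1 i]
  rw [integral_finsetSum _ fun i _ => hinteg i]
  exact Finset.sum_eq_zero fun i _ =>
    h.integral_minkowskiDeriv_of_tsupport_subset (hf1 i) i (hf i)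

end IsIsometricImmersion

end Global

/-! ### The Minkowski inequality -/

section Minkowski

lemma abs_two_mul_mul_mul_sub_le {R s t K : ℝ} (hR : 0 ≤ R) (ht : 0 ≤ t)
    (hst : t + s ^ 2 ≤ R ^ 2) : |2 * s * K * (3 * s ^ 2 - 2 * t)| ≤ 6 * R ^ 3 * |K| := by
  have hs : |s| ≤ R := abs_le_of_sq_le_sq (by linarith) hR
  have hst' : |3 * s ^ 2 - 2 * t| ≤ 3 * R ^ 2 := by
    rw [abs_le]
    constructor <;> nlinarith [sq_nonneg s]
  calc |2 * s * K * (3 * s ^ 2 - 2 * t)|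
      = 2 * |K| * (|s| * |3 * s ^ 2 - 2 * t|) := by
        rw [abs_mul, abs_mul, abs_mul, abs_two]
        ring
    _ ≤ 2 * |K| * (R * (3 * R ^ 2)) := by gcongr
    _ = 6 * R ^ 3 * |K| := by ring

variable {M : Type*} [TopologicalSpace M] [ChartedSpace E3 M]

/-- The squared length of the tangential part of the position vector, computed from its normal
part by Pythagoras. -/
def tangentialSq (φ : M → E4) (p : M) : ℝ := ‖φ p‖ ^ 2 - supportAt φ p ^ 2

lemma tangentialSq_add_supportAt_sq_le {φ : M → E4} {R : ℝ} (hball : ∀ p, ‖φ p‖ ≤ R) (p : M) :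
    tangentialSq φ p + supportAt φ p ^ 2 ≤ R ^ 2 := by
  rw [tangentialSq, sub_add_cancel]
  exact pow_le_pow_left₀ (norm_nonneg _) (hball p) 2

/-- The components of the tangent vector `v` at `p` with respect to the chart at `p`. -/
def chartCoord (p : M) (v : TangentSpace (𝓡 3) p) : E3 := mfderiv (𝓡 3) (𝓡 3) (chartAt E3 p) p v

variable [IsManifold (𝓡 3) ∞ M] {g : SmoothMetric M} {φ : M → E4}

lemma chartCoord_surjective (p : M) : Function.Surjective (chartCoord p) :=
  have : IsManifold (𝓡 3) 1 M := IsManifold.of_le (n := ∞) (by simp)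
  (mdifferentiable_chart (I := 𝓡 3) p).mfderiv_surjective (mem_chart_source E3 p)

lemma ricci_eq_dotProduct_mulVec (g : SmoothMetric M) (p : M) (v w : TangentSpace (𝓡 3) p) :
    ricci g p v w = (chartCoord p v).ofLp ⬝ᵥ
      (Matrix.of (fun i j => ricciCoeff (metricCoeff g p) i j (chartAt E3 p p)) *ᵥ
        (chartCoord p w).ofLp) := by
  simp only [ricci, chartCoord, dotProduct, Matrix.mulVec, Matrix.of_apply, Finset.mul_sum]
  exact Finset.sum_congr rfl fun i _ => Finset.sum_congr rfl fun j _ => by ring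

namespace IsIsometricImmersion

variable (h : IsIsometricImmersion g φ)
include h

lemma ricciCoeff_metricCoeff (p : M) :
    Matrix.of (fun i j => ricciCoeff (metricCoeff g p) i j (chartAt E3 p p)) =
      gaussRicci (chartMap φ p) (chartAt E3 p p) := by
  have hF := h.isImmersionOn_chartMap p
  have hy := mem_chart_target E3 p
  have hfirst : EqOn (metricCoeff g p) (firstForm (chartMap φ p)) (chartAt E3 p).target :=
    fun _ => h.metricCoeff_eq_firstForm p
  have hG : ∀ i j, ContDiffOn ℝ 2 (fun z => firstForm (chartMap φ p) z i j)
      (chartAt E3 p).target := fun i j =>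
    (contDiffOn_metricCoeff g p i j).congr fun z hz => by rw [hfirst hz]
  ext i j
  rw [Matrix.of_apply, ricciCoeff_congr (hfirst.eventuallyEq_of_mem (hF.isOpen.mem_nhds hy)),
    hF.ricciCoeff_firstForm hG hy]

lemma mfderiv_eq_fderiv_chartMap (p : M) (v : TangentSpace (𝓡 3) p) :
    (mfderiv (𝓡 3) (𝓡 4) φ p v : E4) = fderiv ℝ (chartMap φ p) (chartAt E3 p p)
      (chartCoord p v) := by
  have : IsManifold (𝓡 3) 1 M := IsManifold.of_le (n := ∞) (by simp)
  have hp := mem_chart_source E3 p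
  have hφ : φ =ᶠ[𝓝 p] chartMap φ p ∘ chartAt E3 p := by
    filter_upwards [(chartAt E3 p).open_source.mem_nhds hp] with q hq
    rw [Function.comp_apply, chartMap, (chartAt E3 p).left_inv hq]
  have hcomp := mfderiv_comp p
    ((h.isImmersionOn_chartMap p).differentiableAt (mem_chart_target E3 p)).mdifferentiableAt
    ((mdifferentiable_chart (I := 𝓡 3) p).mdifferentiableAt hp)
  rw [mfderiv_eq_fderiv] at hcomp
  rw [hφ.mfderiv_eq]
  exact congrArg (fun L : E3 →L[ℝ] E4 => L v) hcomp

lemma inner_eq_dotProduct_mulVec (p : M) (v w : TangentSpace (𝓡 3) p) :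
    g.inner p v w = (chartCoord p v).ofLp ⬝ᵥ
      (firstForm (chartMap φ p) (chartAt E3 p p) *ᵥ
        (chartCoord p w).ofLp) := by
  rw [dotProduct_firstForm_mulVec, sum_smul_pd, sum_smul_pd, ← h.mfderiv_eq_fderiv_chartMap,
    ← h.mfderiv_eq_fderiv_chartMap]
  exact (h.isometric p v w).symm

lemma mul_dotProduct_firstForm_le_gaussRicci {c : ℝ} {p : M}
    (hRic : ∀ v : TangentSpace (𝓡 3) p, c * g.inner p v v ≤ ricci g p v v) (n : Fin 3 → ℝ) :
    c * (n ⬝ᵥ (firstForm (chartMap φ p) (chartAt E3 p p) *ᵥ n)) ≤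
      n ⬝ᵥ (gaussRicci (chartMap φ p) (chartAt E3 p p) *ᵥ n) := by
  obtain ⟨v, hv⟩ := chartCoord_surjective p (WithLp.toLp 2 n)
  have hv' := hRic v
  rwa [h.inner_eq_dotProduct_mulVec, ricci_eq_dotProduct_mulVec, h.ricciCoeff_metricCoeff,
    hv] at hv'

lemma tangentialSq_eq (p : M) : tangentialSq φ p =
    tangentialCoord (chartMap φ p) (chartAt E3 p p) ⬝ᵥ
      (firstForm (chartMap φ p) (chartAt E3 p p) *ᵥ
        tangentialCoord (chartMap φ p) (chartAt E3 p p)) := by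
  rw [tangentialSq, ← chartMap_chart φ p,
    (h.isImmersionOn_chartMap p).norm_sq_position (mem_chart_target E3 p), supportAt,
    add_sub_cancel_right]

lemma tangentialSq_nonneg (p : M) : 0 ≤ tangentialSq φ p := by
  rw [h.tangentialSq_eq, dotProduct_firstForm_mulVec]
  exact real_inner_self_nonneg

lemma continuous_tangentialSq : Continuous (tangentialSq φ) :=
  (h.contMDiff.continuous.norm.pow 2).sub h.continuous_supportAt_sq

lemma le_minkowskiDeriv_one {R c : ℝ} (hball : ∀ p, ‖φ p‖ ≤ R)
    (hRic : ∀ (p : M) (v : TangentSpace (𝓡 3) p), -c * g.inner p v v ≤ ricci g p v v) (p : M) :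
    6 - c * tangentialSq φ p - 6 * R ^ 3 * |gaussKronecker φ p| ≤
      minkowskiDeriv φ (fun _ => 1) p := by
  have hF := h.isImmersionOn_chartMap p
  have hy := mem_chart_target E3 p
  have hricci := h.mul_dotProduct_firstForm_le_gaussRicci (hRic p)
    (tangentialCoord (chartMap φ p) (chartAt E3 p p))
  have hcurv := abs_two_mul_mul_mul_sub_le (K := gaussKronecker φ p)
    ((norm_nonneg _).trans (hball p)) (h.tangentialSq_nonneg p)
    (tangentialSq_add_supportAt_sq_le hball p)
  rw [← h.tangentialSq_eq] at hricci
  rw [minkowskiDeriv, hF.minkowskiDensity_one hy,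
    mul_div_cancel_left₀ _ (hF.sqrt_det_firstForm_pos hy).ne', ← h.tangentialSq_eq]
  change _ ≤ _ + 2 * supportAt φ p * gaussKronecker φ p * (3 * supportAt φ p ^ 2 - _)
  linarith [(abs_le.1 hcurv).1]

lemma tangentialSq_eq_zero_of_isLocalMax {p : M} (hp : IsLocalMax (fun q => ‖φ q‖ ^ 2) p) :
    tangentialSq φ p = 0 := by
  have hF := h.isImmersionOn_chartMap p
  have hy := mem_chart_target E3 p
  have hmax : IsLocalMax (fun y => inner ℝ (chartMap φ p y) (chartMap φ p y))
      (chartAt E3 p p) := by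
    refine (((chartAt E3 p).tendsto_symm (mem_chart_source E3 p)).eventually hp).mono
      fun y hy => ?_
    simp only [real_inner_self_eq_norm_sq, chartMap_chart]
    exact hy
  have hperp : ∀ j, inner ℝ (pd j (chartMap φ p) (chartAt E3 p p))
      (chartMap φ p (chartAt E3 p p)) = (0 : ℝ) := by
    intro j
    have hpd : pd j (fun y => inner ℝ (chartMap φ p y) (chartMap φ p y)) (chartAt E3 p p) = 0 := by
      rw [pd, hmax.fderiv_eq_zero]
      rfl
    rw [pd_inner (hF.differentiableAt hy) (hF.differentiableAt hy),
      real_inner_comm (pd j (chartMap φ p) (chartAt E3 p p))] at hpd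
    linarith
  have hcoord : tangentialCoord (chartMap φ p) (chartAt E3 p p) = 0 := by
    ext k
    simp [tangentialCoord, hperp]
  rw [h.tangentialSq_eq, hcoord, zero_dotProduct]

lemma exists_tangentialSq_eq_zero [CompactSpace M] [Nonempty M] : ∃ p, tangentialSq φ p = 0 := by
  obtain ⟨p, -, hp⟩ := isCompact_univ.exists_isMaxOn univ_nonempty
    (h.contMDiff.continuous.norm.pow 2).continuousOn
  exact ⟨p, h.tangentialSq_eq_zero_of_isLocalMax (hp.isLocalMax univ_mem)⟩

variable [CompactSpace M] [MeasurableSpace M] [BorelSpace M]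

lemma integrable_abs_gaussKronecker : Integrable (fun p => |gaussKronecker φ p|) (vol g) :=
  have := isFiniteMeasure_vol g
  h.continuous_abs_gaussKronecker.integrable_of_hasCompactSupport (.of_compactSpace _)

lemma integrable_tangentialSq : Integrable (tangentialSq φ) (vol g) :=
  have := isFiniteMeasure_vol g
  h.continuous_tangentialSq.integrable_of_hasCompactSupport (.of_compactSpace _)

lemma six_mul_vol_sub_le [T2Space M] {R c : ℝ} (hball : ∀ p, ‖φ p‖ ≤ R)
    (hRic : ∀ (p : M) (v : TangentSpace (𝓡 3) p), -c * g.inner p v v ≤ ricci g p v v) :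
    6 * (vol g).real univ - c * ∫ p, tangentialSq φ p ∂(vol g) ≤
      6 * R ^ 3 * totalCurvature g φ := by
  have := isFiniteMeasure_vol g
  have hT := h.integrable_tangentialSq.const_mul c
  have hK := h.integrable_abs_gaussKronecker.const_mul (6 * R ^ 3)
  have h6T : Integrable (fun p => 6 - c * tangentialSq φ p) (vol g) := (integrable_const 6).sub hT
  have hle := integral_mono (h6T.sub hK) ((h.continuous_minkowskiDeriv contMDiff_const
    ).integrable_of_hasCompactSupport (.of_compactSpace _)) (h.le_minkowskiDeriv_one hball hRic)
  simp only [Pi.sub_apply] at hle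
  rw [h.integral_minkowskiDeriv_one, integral_sub h6T hK, integral_sub (integrable_const _) hT,
    integral_const_mul, integral_const_mul, integral_const, smul_eq_mul] at hle
  rw [totalCurvature]
  linarith

lemma integral_tangentialSq_lt [Nonempty M] {R : ℝ} (hR : R ≠ 0) (hball : ∀ p, ‖φ p‖ ≤ R) :
    ∫ p, tangentialSq φ p ∂(vol g) < R ^ 2 * (vol g).real univ := by
  have := isFiniteMeasure_vol g
  have := isOpenPosMeasure_vol g
  obtain ⟨p, hp⟩ := h.exists_tangentialSq_eq_zero
  have hpos : 0 < ∫ p, (R ^ 2 - tangentialSq φ p) ∂(vol g) := by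
    refine (continuous_const.sub h.continuous_tangentialSq
      ).integral_pos_of_hasCompactSupport_nonneg_nonzero (.of_compactSpace _) (fun q => ?_)
      (x := p) (by simp [hp, hR])
    simp only [Pi.zero_apply]
    linarith [tangentialSq_add_supportAt_sq_le hball q, sq_nonneg (supportAt φ q)]
  rw [integral_sub (integrable_const _) h.integrable_tangentialSq, integral_const,
    smul_eq_mul] at hpos
  linarith

end IsIsometricImmersion

end Minkowski

end Hypersurface

end

theorem mainTheorem2 {M : Type*} [TopologicalSpace M] [ChartedSpace Hypersurface.E3 M]
    [IsManifold (𝓡 3) ∞ M] [T2Space M] [CompactSpace M] [Nonempty M]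
    [MeasurableSpace M] [BorelSpace M]
    (g : Hypersurface.SmoothMetric M) (φ : M → Hypersurface.E4)
    (hφ : Hypersurface.IsIsometricImmersion g φ)
    (R : ℝ) (hR : 0 < R) (hball : range φ ⊆ Metric.closedBall 0 R)
    (α : ℝ) (hα₀ : 0 < α) (hα₆ : α < 6)
    (hRic : ∀ (p : M) (v : TangentSpace (𝓡 3) p),
      -(α / R ^ 2) * g.inner p v v ≤ Hypersurface.ricci g p v v) :
    Hypersurface.vol g univ < ⊤ ∧
    Integrable (fun p => |Hypersurface.gaussKronecker φ p|) (Hypersurface.vol g) ∧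
    (Hypersurface.vol g).real univ <
      6 / (6 - α) * R ^ 3 * Hypersurface.totalCurvature g φ := by
  have := Hypersurface.isFiniteMeasure_vol g
  have hnorm : ∀ p, ‖φ p‖ ≤ R := fun p => by simpa using hball (mem_range_self p)
  have hmink := hφ.six_mul_vol_sub_le hnorm hRic
  have hlt : α / R ^ 2 * ∫ p, Hypersurface.tangentialSq φ p ∂(Hypersurface.vol g) <
      α * (Hypersurface.vol g).real univ := calc
    _ < α / R ^ 2 * (R ^ 2 * (Hypersurface.vol g).real univ) := by
      gcongr
      exact hφ.integral_tangentialSq_lt hR.ne' hnorm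
    _ = α * (Hypersurface.vol g).real univ := by field_simp
  refine ⟨measure_lt_top _ _, hφ.integrable_abs_gaussKronecker, ?_⟩
  rw [div_mul_eq_mul_div, div_mul_eq_mul_div, lt_div_iff₀ (sub_pos.2 hα₆)]
  linarith
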